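/- Let $A$ and $B$ be rings (associative with $1$), and let ${}_B\Sigma_A$ be a $(B,A)$-bimodule such that ${}_B\Sigma$ is faithful and $\Sigma_A$ is finitely generated and projective. Let $\Sigma^*=\mathrm{Hom}(\Sigma_A,A_A)$, an $(A,B)$-bimodule, let $\{(e_i,e_i^*)\}_{i}\subset\Sigma\times\Sigma^*$ be a finite dual basis of $\Sigma_A$, and let $\mathfrak C=\Sigma^*\otimes_B\Sigma$ be the comatrix $A$-coring, with comultiplication $u^*\otimes_B u\mapsto\sum_i (u^*\otimes_B e_i)\otimes_A(e_i^*\otimes_B u)$ and counit $u^*\otimes_B u\mapsto u^*(u)$. Let $\mathrm{End}_A(\mathfrak C)$ be the monoid of $A$-coring endomorphisms of $\mathfrak C$ under composition. Then $\Sigma$ is a right $\mathfrak C$-comodule with coaction $\rho_\Sigma(u)=\sum_i e_i\otimes_A(e_i^*\otimes_B u)$, and for $g\in\mathrm{End}_A(\mathfrak C)$ let $\Sigma_g$ be the right $\mathfrak C$-comodule $\Sigma$ with coaction $(\Sigma\otimes_A g)\circ\rho_\Sigma$. Let $S=\mathrm{End}(\Sigma_A)$, with $B$ regarded as a subring of $S$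 through its action on $\Sigma$. Let $\mathbf I_B(S)$ be the monoid of $B$-sub-bimodules of $S$ under the product $IJ$ (the additive subgroup generated by all $xy$ with $x\in I$, $y\in J$), with unit $B$, and let $\mathbf I^r_B(S)$ be its submonoid of all $I$ for which the multiplication map $\mathbf m\colon I\otimes_B S\to S$, $x\otimes_B s\mapsto xs$, is bijective. Assume that either (a) ${}_B\Sigma$ is faithfully flat, or (b) ${}_B\Sigma_A$ is a separable bimodule, i.e. the evaluation map $\Sigma\otimes_A{}^*\Sigma\to B$, $m\otimes_A\varphi\mapsto\varphi(m)$, where ${}^*\Sigma=\mathrm{Hom}({}_B\Sigma,{}_BB)$, is a split epimorphism of $(B,B)$-bimodules. Then $$\digamma^r\colon\mathrm{End}_A(\mathfrak C)\to\mathbf I^r_B(S),\qquad g\mapsto\mathrm{Hom}_{\mathfrak C}(\Sigma,\Sigma_g)\subseteq S,$$ is a well-defined anti-isomorphism of monoids, whose inverse $\Gamma^r$ sends $I\in\mathbf I^r_B(S)$ to the coring endomorphism $$u^*\otimes_B u\mapsto\sum_k u^*t_k\otimes_B s_k u,\qquad\text{where }\ \mathbf m^{-1}(1)=\sum_k t_k\otimes_B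 s_k\in I\otimes_B S,$$ with $u^*t_k=u^*\circ t_k$ and $s_ku=s_k(u)$. -/

import Mathlib

/-
Conventions.  All rings are associative and unital, not necessarily commutative.
A right `R`-module is a `Module Rᵐᵒᵖ M`, the product `m r` being written `op r • m`;
an `(L, R)`-bimodule has `Module L M`, `Module Rᵐᵒᵖ M` and `SMulCommClass L Rᵐᵒᵖ M`.
-/

namespace ComatrixCoring

open MulOpposite
open scoped TensorProduct Pointwise

/-! ### The tensor product over a noncommutative ring -/

section Tensor

/-- The relations `m r ⊗ n - m ⊗ r n`. -/
def balancedRel (R M N : Type*) [Ring R] [AddCommGroup M] [Module Rᵐᵒᵖ M]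
    [AddCommGroup N] [Module R N] : AddSubgroup (M ⊗[ℤ] N) :=
  AddSubgroup.closure {z | ∃ (m : M) (r : R) (n : N),
    z = (op r • m) ⊗ₜ[ℤ] n - m ⊗ₜ[ℤ] (r • n)}

/-- The tensor product `M ⊗_R N` of a right `R`-module `M` and a left `R`-module `N`. -/
def Tens (R M N : Type*) [Ring R] [AddCommGroup M] [Module Rᵐᵒᵖ M]
    [AddCommGroup N] [Module R N] : Type _ :=
  (M ⊗[ℤ] N) ⧸ balancedRel R M N

namespace Tens

variable {R M N : Type*} [Ring R] [AddCommGroup M] [Module Rᵐᵒᵖ M]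
  [AddCommGroup N] [Module R N]

instance instAddCommGroup : AddCommGroup (Tens R M N) :=
  inferInstanceAs (AddCommGroup ((M ⊗[ℤ] N) ⧸ balancedRel R M N))

variable (R) in
/-- The pure tensor `m ⊗_R n`. -/
def tmul (m : M) (n : N) : Tens R M N :=
  QuotientAddGroup.mk' (balancedRel R M N) (m ⊗ₜ[ℤ] n)

theorem add_tmul (m m' : M) (n : N) : tmul R (m + m') n = tmul R m n + tmul R m' n := by
  simp only [tmul, TensorProduct.add_tmul, map_add]; rfl

theorem tmul_add (m : M) (n n' : N) : tmul R m (n + n') = tmul R m n + tmul R m n' := by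
  simp only [tmul, TensorProduct.tmul_add, map_add]; rfl

theorem smul_tmul (m : M) (r : R) (n : N) : tmul R (op r • m) n = tmul R m (r • n) := by
  have h : (op r • m) ⊗ₜ[ℤ] n - m ⊗ₜ[ℤ] (r • n) ∈ balancedRel R M N :=
    AddSubgroup.subset_closure ⟨m, r, n, rfl⟩
  have h' := (QuotientAddGroup.eq_zero_iff _).2 h
  exact sub_eq_zero.1 h'

/-- Pure tensors as a biadditive map. -/
def tmulHom (R M N : Type*) [Ring R] [AddCommGroup M] [Module Rᵐᵒᵖ M]
    [AddCommGroup N] [Module R N] : M →+ N →+ Tens R M N :=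
  AddMonoidHom.mk' (fun m => AddMonoidHom.mk' (fun n => tmul R m n) (tmul_add m))
    (fun m m' => by ext n; exact add_tmul m m' n)

@[simp] theorem tmulHom_apply (m : M) (n : N) : tmulHom R M N m n = tmul R m n := rfl

theorem zero_tmul (n : N) : tmul R (0 : M) n = 0 := by
  rw [← tmulHom_apply, map_zero]; rfl

theorem tmul_zero (m : M) : tmul R m (0 : N) = 0 := by
  rw [← tmulHom_apply, map_zero]

theorem sum_tmul {ι : Type*} (s : Finset ι) (f : ι → M) (n : N) :
    tmul R (∑ i ∈ s, f i) n = ∑ i ∈ s, tmul R (f i) n := by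
  rw [← tmulHom_apply, map_sum, AddMonoidHom.finsetSum_apply]; rfl

theorem tmul_sum {ι : Type*} (s : Finset ι) (m : M) (f : ι → N) :
    tmul R m (∑ i ∈ s, f i) = ∑ i ∈ s, tmul R m (f i) := by
  rw [← tmulHom_apply, map_sum]; rfl

@[elab_as_elim]
theorem induction_on {p : Tens R M N → Prop} (z : Tens R M N)
    (zero : p 0) (tmul : ∀ m n, p (tmul R m n)) (add : ∀ x y, p x → p y → p (x + y)) : p z := by
  obtain ⟨w, rfl⟩ := QuotientAddGroup.mk'_surjective (balancedRel R M N) z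
  induction w using TensorProduct.induction_on with
  | zero => rw [map_zero]; exact zero
  | tmul m n => exact tmul m n
  | add x y hx hy => rw [map_add]; exact add _ _ hx hy

theorem addHom_ext {P : Type*} [AddCommGroup P] {f g : Tens R M N →+ P}
    (h : ∀ m n, f (tmul R m n) = g (tmul R m n)) : f = g := by
  ext z
  induction z using induction_on with
  | zero => simp
  | tmul m n => exact h m n
  | add x y hx hy => rw [map_add, map_add, hx, hy]

/-- The additive map out of `M ⊗_R N` given by a balanced biadditive map. -/
def lift {P : Type*} [AddCommGroup P] (f : M →+ N →+ P)
    (hf : ∀ (m : M) (r : R) (n : N), f (op r • m) n = f m (r • n)) : Tens R M N →+ P :=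
  QuotientAddGroup.lift (balancedRel R M N)
    (TensorProduct.liftAddHom f (fun z m n => by
      rw [map_zsmul, map_zsmul]; rfl))
    (by
      refine (AddSubgroup.closure_le _).2 ?_
      rintro _ ⟨m, r, n, rfl⟩
      simp [hf])

@[simp] theorem lift_tmul {P : Type*} [AddCommGroup P] (f : M →+ N →+ P)
    (hf : ∀ (m : M) (r : R) (n : N), f (op r • m) n = f m (r • n)) (m : M) (n : N) :
    lift f hf (tmul R m n) = f m n := rfl

/-- The map `f ⊗_R g`. -/
def map {M' N' : Type*} [AddCommGroup M'] [Module Rᵐᵒᵖ M'] [AddCommGroup N'] [Module R N']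
    (f : M →ₗ[Rᵐᵒᵖ] M') (g : N →ₗ[R] N') : Tens R M N →+ Tens R M' N' :=
  lift (((tmulHom R M' N').comp f.toAddMonoidHom).compr₂ (AddMonoidHom.id _) |>.compl₂
      g.toAddMonoidHom)
    (fun m r n => by
      change tmul R (f (op r • m)) (g n) = tmul R (f m) (g (r • n))
      rw [map_smul, map_smul, smul_tmul])

@[simp] theorem map_tmul {M' N' : Type*} [AddCommGroup M'] [Module Rᵐᵒᵖ M']
    [AddCommGroup N'] [Module R N'] (f : M →ₗ[Rᵐᵒᵖ] M') (g : N →ₗ[R] N') (m : M) (n : N) :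
    map f g (tmul R m n) = tmul R (f m) (g n) := rfl

/-- If `M` is an `(L, R)`-bimodule, then `L` acts on `M ⊗_R N` by `l (m ⊗ n) = l m ⊗ n`. -/
instance instModuleLeft {L : Type*} [Ring L] [Module L M] [SMulCommClass L Rᵐᵒᵖ M] :
    Module L (Tens R M N) where
  smul l z := map (Module.toModuleEnd Rᵐᵒᵖ M l) LinearMap.id z
  one_smul z := by
    change map _ _ z = z
    induction z using induction_on with
    | zero => simp
    | tmul m n => simp
    | add x y hx hy => rw [map_add, hx, hy]
  mul_smul a b z := by
    change map _ _ z = map _ _ (map _ _ z)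
    induction z using induction_on with
    | zero => simp
    | tmul m n => simp [mul_smul]
    | add x y hx hy => rw [map_add, hx, hy, map_add, map_add]
  smul_zero a := map_zero _
  smul_add a x y := map_add _ x y
  add_smul a b z := by
    change map _ _ z = map _ _ z + map _ _ z
    induction z using induction_on with
    | zero => simp
    | tmul m n => simp [add_smul, add_tmul]
    | add x y hx hy => rw [map_add, hx, hy, map_add, map_add]; abel
  zero_smul z := by
    change map _ _ z = 0
    induction z using induction_on with
    | zero => simp
    | tmul m n => simp [zero_tmul]
    | add x y hx hy => rw [map_add, hx, hy, add_zero]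

/-- If `N` is an `(R, K)`-bimodule, then `K` acts on `M ⊗_R N` by `(m ⊗ n) k = m ⊗ n k`. -/
instance instModuleRight {K : Type*} [Ring K] [Module Kᵐᵒᵖ N] [SMulCommClass R Kᵐᵒᵖ N] :
    Module Kᵐᵒᵖ (Tens R M N) :=
  haveI : SMulCommClass Kᵐᵒᵖ R N := SMulCommClass.symm _ _ _
  { smul := fun k z => map LinearMap.id (Module.toModuleEnd R N k) z
    one_smul := fun z => by
      change map _ _ z = z
      induction z using induction_on with
      | zero => simp
      | tmul m n => simp
      | add x y hx hy => rw [map_add, hx, hy]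
    mul_smul := fun a b z => by
      change map _ _ z = map _ _ (map _ _ z)
      induction z using induction_on with
      | zero => simp
      | tmul m n => simp [mul_smul]
      | add x y hx hy => rw [map_add, hx, hy, map_add, map_add]
    smul_zero := fun a => map_zero _
    smul_add := fun a x y => map_add _ x y
    add_smul := fun a b z => by
      change map _ _ z = map _ _ z + map _ _ z
      induction z using induction_on with
      | zero => simp
      | tmul m n => simp [add_smul, tmul_add]
      | add x y hx hy => rw [map_add, hx, hy, map_add, map_add]; abel
    zero_smul := fun z => by
      change map _ _ z = 0
      induction z using induction_on with
      | zero => simp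
      | tmul m n => simp [tmul_zero]
      | add x y hx hy => rw [map_add, hx, hy, add_zero] }

theorem left_smul_tmul {L : Type*} [Ring L] [Module L M] [SMulCommClass L Rᵐᵒᵖ M]
    (l : L) (m : M) (n : N) : l • tmul R m n = tmul R (l • m) n := rfl

theorem right_smul_tmul {K : Type*} [Ring K] [Module Kᵐᵒᵖ N] [SMulCommClass R Kᵐᵒᵖ N]
    (k : K) (m : M) (n : N) : op k • tmul R m n = tmul R m (op k • n) := rfl

instance instSMulCommClass {L K : Type*} [Ring L] [Module L M] [SMulCommClass L Rᵐᵒᵖ M]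
    [Ring K] [Module Kᵐᵒᵖ N] [SMulCommClass R Kᵐᵒᵖ N] :
    SMulCommClass L Kᵐᵒᵖ (Tens R M N) where
  smul_comm l k z := by
    induction k using MulOpposite.rec' with
    | h k =>
      induction z using induction_on with
      | zero => rw [smul_zero, smul_zero, smul_zero]
      | tmul m n => rw [right_smul_tmul, left_smul_tmul, left_smul_tmul, right_smul_tmul]
      | add x y hx hy => rw [smul_add, smul_add, smul_add, smul_add, hx, hy]

/-- For `N` an `(R, T)`-bimodule and `z : Z`, the `R`-linear map `N → N ⊗_T Z`, `y ↦ y ⊗ z`. -/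
def tmulRight {T Z : Type*} [Ring T] [Module Tᵐᵒᵖ N] [SMulCommClass R Tᵐᵒᵖ N]
    [AddCommGroup Z] [Module T Z] (z : Z) : N →ₗ[R] Tens T N Z where
  toFun y := tmul T y z
  map_add' y y' := add_tmul y y' z
  map_smul' _ _ := rfl

/-- The canonical map `(X ⊗_R Y) ⊗_T Z → X ⊗_R (Y ⊗_T Z)`. -/
def assoc (R T X Y Z : Type*) [Ring R] [Ring T] [AddCommGroup X] [Module Rᵐᵒᵖ X]
    [AddCommGroup Y] [Module R Y] [Module Tᵐᵒᵖ Y] [SMulCommClass R Tᵐᵒᵖ Y]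
    [AddCommGroup Z] [Module T Z] :
    Tens T (Tens R X Y) Z →+ Tens R X (Tens T Y Z) :=
  lift (AddMonoidHom.flip (AddMonoidHom.mk'
      (fun z => map (LinearMap.id : X →ₗ[Rᵐᵒᵖ] X) (tmulRight (T := T) (N := Y) z))
      (fun z z' => addHom_ext fun x y => by
        change tmul R x (tmul T y (z + z')) = tmul R x (tmul T y z) + tmul R x (tmul T y z')
        rw [tmul_add, tmul_add])))
    (fun w t z => by
      change map _ (tmulRight z) (op t • w) = map _ (tmulRight (t • z)) w
      induction w using induction_on with
      | zero => rw [smul_zero, map_zero, map_zero]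
      | tmul x y =>
        change tmul R x (tmul T (op t • y) z) = tmul R x (tmul T y (t • z))
        rw [smul_tmul]
      | add a b ha hb => rw [smul_add, map_add, map_add, ha, hb])

@[simp] theorem assoc_tmul {T X Y Z : Type*} [Ring T] [AddCommGroup X] [Module Rᵐᵒᵖ X]
    [AddCommGroup Y] [Module R Y] [Module Tᵐᵒᵖ Y] [SMulCommClass R Tᵐᵒᵖ Y]
    [AddCommGroup Z] [Module T Z] (x : X) (y : Y) (z : Z) :
    assoc R T X Y Z (tmul T (tmul R x y) z) = tmul R x (tmul T y z) := rfl

/-- The canonical map `R ⊗_R N → N`. -/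
def lid (R N : Type*) [Ring R] [AddCommGroup N] [Module R N] : Tens R R N →+ N :=
  lift (AddMonoidHom.mk' (fun r => AddMonoidHom.mk' (fun n => r • n) (smul_add r))
      (fun r r' => by ext n; exact add_smul r r' n))
    (fun m r n => by
      change (op r • m) • n = m • r • n
      rw [op_smul_eq_mul, mul_smul])

@[simp] theorem lid_tmul (r : R) (n : N) : lid R N (tmul R r n) = r • n := rfl

/-- The canonical map `M ⊗_R R → M`. -/
def rid (R M : Type*) [Ring R] [AddCommGroup M] [Module Rᵐᵒᵖ M] : Tens R M R →+ M :=
  lift (AddMonoidHom.mk' (fun m => AddMonoidHom.mk' (fun r => op r • m)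
        (fun r r' => by rw [op_add, add_smul]))
      (fun m m' => by ext r; exact smul_add _ m m'))
    (fun m r n => by
      change op n • op r • m = op (r • n) • m
      rw [smul_smul, smul_eq_mul, op_mul])

@[simp] theorem rid_tmul (m : M) (r : R) : rid R M (tmul R m r) = op r • m := rfl

end Tens

end Tensor

/-! ### Bimodule maps, faithful flatness, separable bimodules -/

/-- Homomorphisms of `(L, R)`-bimodules. -/
structure BimodHom (L R M N : Type*) [Ring L] [Ring R] [AddCommGroup M] [Module L M]
    [Module Rᵐᵒᵖ M] [AddCommGroup N] [Module L N] [Module Rᵐᵒᵖ N] extends M →ₗ[L] N where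
  map_op_smul' : ∀ (r : R) (m : M), toFun (op r • m) = op r • toFun m

namespace BimodHom

variable {L R M N : Type*} [Ring L] [Ring R] [AddCommGroup M] [Module L M]
    [Module Rᵐᵒᵖ M] [AddCommGroup N] [Module L N] [Module Rᵐᵒᵖ N]

instance instFunLike : FunLike (BimodHom L R M N) M N where
  coe f := f.toFun
  coe_injective f g h := by
    obtain ⟨f, _⟩ := f
    obtain ⟨g, _⟩ := g
    congr
    exact DFunLike.coe_injective h

@[ext] theorem ext {f g : BimodHom L R M N} (h : ∀ m, f m = g m) : f = g := DFunLike.ext f g h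

/-- The underlying homomorphism of left modules. -/
def toLeft (f : BimodHom L R M N) : M →ₗ[L] N := f.toLinearMap

/-- The underlying homomorphism of right modules. -/
def toRight (f : BimodHom L R M N) : M →ₗ[Rᵐᵒᵖ] N where
  toFun := f
  map_add' := f.toLinearMap.map_add
  map_smul' r m := f.map_op_smul' r.unop m

theorem map_add (f : BimodHom L R M N) (x y : M) : f (x + y) = f x + f y := f.toLeft.map_add x y
theorem map_zero (f : BimodHom L R M N) : f 0 = 0 := f.toLeft.map_zero

@[simp] theorem toLeft_apply (f : BimodHom L R M N) (m : M) : f.toLeft m = f m := rfl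
@[simp] theorem toRight_apply (f : BimodHom L R M N) (m : M) : f.toRight m = f m := rfl

end BimodHom

/-- The left `B`-module `M` is faithfully flat: `- ⊗_B M` preserves injectivity of homomorphisms
of right `B`-modules, and `N ⊗_B M = 0` only if `N = 0`. -/
def IsFaithfullyFlat.{u, v} (B : Type u) (M : Type v) [Ring B] [AddCommGroup M] [Module B M] :
    Prop :=
  (∀ (N N' : Type (max u v)) [AddCommGroup N] [Module Bᵐᵒᵖ N] [AddCommGroup N'] [Module Bᵐᵒᵖ N']
    (f : N →ₗ[Bᵐᵒᵖ] N'), Function.Injective f →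
      Function.Injective (Tens.map f (LinearMap.id : M →ₗ[B] M))) ∧
  (∀ (N : Type (max u v)) [AddCommGroup N] [Module Bᵐᵒᵖ N],
    Subsingleton (Tens B N M) → Subsingleton N)

section Duals

variable (A B M : Type*) [Ring A] [Ring B] [AddCommGroup M] [Module B M] [Module Aᵐᵒᵖ M]

/-- The right dual `M^* = Hom(M_A, A_A)`. -/
def RightDual : Type _ := M →ₗ[Aᵐᵒᵖ] A

/-- The left dual `^*M = Hom(_B M, _B B)`. -/
def LeftDual : Type _ := M →ₗ[B] B

namespace RightDual

instance instAddCommGroup : AddCommGroup (RightDual A M) :=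
  inferInstanceAs (AddCommGroup (M →ₗ[Aᵐᵒᵖ] A))

instance instFunLike : FunLike (RightDual A M) M A := inferInstanceAs (FunLike (M →ₗ[Aᵐᵒᵖ] A) M A)

/-- `(a f)(m) = a f(m)`. -/
instance instModuleLeft : Module A (RightDual A M) := inferInstanceAs (Module A (M →ₗ[Aᵐᵒᵖ] A))

variable {A M}

@[ext] theorem ext {f g : RightDual A M} (h : ∀ m, f m = g m) : f = g := LinearMap.ext h

@[simp] theorem add_apply (f g : RightDual A M) (m : M) : (f + g) m = f m + g m := rfl
@[simp] theorem zero_apply (m : M) : (0 : RightDual A M) m = 0 := rfl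
@[simp] theorem smul_apply (a : A) (f : RightDual A M) (m : M) : (a • f) m = a * f m := rfl
theorem map_add (f : RightDual A M) (m m' : M) : f (m + m') = f m + f m' := LinearMap.map_add f m m'
theorem map_zero (f : RightDual A M) : f (0 : M) = 0 := LinearMap.map_zero f
theorem map_op_smul (f : RightDual A M) (a : A) (m : M) : f (op a • m) = f m * a :=
  LinearMap.map_smul f (op a) m

theorem sum_apply {ι : Type*} (s : Finset ι) (f : ι → RightDual A M) (m : M) :
    (∑ i ∈ s, f i) m = ∑ i ∈ s, f i m := LinearMap.sum_apply s f m

/-- The right action of `End(M_A)` on `M^*`: `(f s)(m) = f(s(m))`. -/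
def comp (f : RightDual A M) (s : Module.End Aᵐᵒᵖ M) : RightDual A M :=
  LinearMap.comp (f : M →ₗ[Aᵐᵒᵖ] A) s

@[simp] theorem comp_apply (f : RightDual A M) (s : Module.End Aᵐᵒᵖ M) (m : M) :
    comp f s m = f (s m) := rfl

variable {B} [SMulCommClass B Aᵐᵒᵖ M]

/-- `(f b)(m) = f(b m)`. -/
instance instModuleRight : Module Bᵐᵒᵖ (RightDual A M) where
  smul b f := comp f (Module.toModuleEnd Aᵐᵒᵖ M b.unop)
  one_smul f := by
    ext m; change f ((1 : Bᵐᵒᵖ).unop • m) = f m; simp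
  mul_smul a b f := by
    ext m; change f ((a * b).unop • m) = f (b.unop • a.unop • m); simp [mul_smul]
  smul_zero a := rfl
  smul_add a f g := rfl
  add_smul a b f := by
    ext m; change f ((a + b).unop • m) = f (a.unop • m) + f (b.unop • m)
    rw [unop_add, add_smul, map_add]
  zero_smul f := by
    ext m; change f ((0 : Bᵐᵒᵖ).unop • m) = 0
    rw [unop_zero, zero_smul, map_zero]

@[simp] theorem op_smul_apply (b : B) (f : RightDual A M) (m : M) : (op b • f) m = f (b • m) := rfl

instance instSMulCommClass : SMulCommClass A Bᵐᵒᵖ (RightDual A M) where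
  smul_comm _ _ _ := rfl

end RightDual

namespace LeftDual

instance instAddCommGroup : AddCommGroup (LeftDual B M) :=
  inferInstanceAs (AddCommGroup (M →ₗ[B] B))

instance instFunLike : FunLike (LeftDual B M) M B := inferInstanceAs (FunLike (M →ₗ[B] B) M B)

/-- `(φ b)(m) = φ(m) b`. -/
instance instModuleRight : Module Bᵐᵒᵖ (LeftDual B M) := inferInstanceAs (Module Bᵐᵒᵖ (M →ₗ[B] B))

variable {A B M}

@[ext] theorem ext {f g : LeftDual B M} (h : ∀ m, f m = g m) : f = g := LinearMap.ext h

@[simp] theorem add_apply (f g : LeftDual B M) (m : M) : (f + g) m = f m + g m := rfl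
@[simp] theorem zero_apply (m : M) : (0 : LeftDual B M) m = 0 := rfl
@[simp] theorem op_smul_apply (b : B) (f : LeftDual B M) (m : M) : (op b • f) m = f m * b := rfl
theorem map_add (f : LeftDual B M) (m m' : M) : f (m + m') = f m + f m' := LinearMap.map_add f m m'
theorem map_zero (f : LeftDual B M) : f (0 : M) = 0 := LinearMap.map_zero f
theorem map_smul (f : LeftDual B M) (b : B) (m : M) : f (b • m) = b * f m := LinearMap.map_smul f b m

variable [SMulCommClass B Aᵐᵒᵖ M]

/-- `(a φ)(m) = φ(m a)`. -/
instance instModuleLeft : Module A (LeftDual B M) :=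
  haveI : SMulCommClass Aᵐᵒᵖ B M := SMulCommClass.symm _ _ _
  { smul := fun a f => (LinearMap.comp (f : M →ₗ[B] B) (Module.toModuleEnd B M (op a)) : M →ₗ[B] B)
    one_smul := fun f => by
      ext m; change f (op (1 : A) • m) = f m; simp
    mul_smul := fun a b f => by
      ext m; change f (op (a * b) • m) = f (op b • op a • m); simp [mul_smul]
    smul_zero := fun a => rfl
    smul_add := fun a f g => rfl
    add_smul := fun a b f => by
      ext m; change f (op (a + b) • m) = f (op a • m) + f (op b • m)
      rw [op_add, add_smul, map_add]
    zero_smul := fun f => by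
      ext m; change f (op (0 : A) • m) = 0
      rw [op_zero, zero_smul, map_zero] }

@[simp] theorem smul_apply (a : A) (f : LeftDual B M) (m : M) : (a • f) m = f (op a • m) := rfl

instance instSMulCommClass : SMulCommClass A Bᵐᵒᵖ (LeftDual B M) where
  smul_comm _ _ _ := rfl

end LeftDual

variable [SMulCommClass B Aᵐᵒᵖ M]

/-- The evaluation map `M ⊗_A ^*M → B`, `m ⊗ φ ↦ φ(m)`, a homomorphism of `(B, B)`-bimodules. -/
def leftEval : BimodHom B B (Tens A M (LeftDual B M)) B :=
  let ev : Tens A M (LeftDual B M) →+ B :=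
    Tens.lift (AddMonoidHom.mk' (fun m => AddMonoidHom.mk' (fun f : LeftDual B M => f m)
        (fun f g => LeftDual.add_apply f g m))
        (fun m m' => by ext f; exact LeftDual.map_add f m m'))
      (fun m a f => rfl)
  { toFun := ev
    map_add' := ev.map_add
    map_smul' := fun b z => by
      induction z using Tens.induction_on with
      | zero => simp
      | tmul m f => exact LeftDual.map_smul f b m
      | add x y hx hy => rw [smul_add, map_add, hx, hy, map_add, smul_add]
    map_op_smul' := fun b z => by
      change ev _ = op b • ev _
      induction z using Tens.induction_on with
      | zero => simp
      | tmul m f => rfl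
      | add x y hx hy => rw [smul_add, map_add, hx, hy, map_add, smul_add] }

@[simp] theorem leftEval_tmul (m : M) (f : LeftDual B M) :
    leftEval A B M (Tens.tmul A m f) = f m := rfl

/-- The bimodule `_B M_A` is separable: the evaluation `M ⊗_A ^*M → B` is a split epimorphism of
`(B, B)`-bimodules. -/
def IsSeparableBimodule : Prop :=
  ∃ σ : BimodHom B B B (Tens A M (LeftDual B M)), ∀ b : B, leftEval A B M (σ b) = b

/-- A finite dual basis of the right `A`-module `M`. -/
structure DualBasis (A M : Type*) [Ring A] [AddCommGroup M] [Module Aᵐᵒᵖ M] where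
  n : ℕ
  e : Fin n → M
  eStar : Fin n → RightDual A M
  sum_eq : ∀ x : M, ∑ i, op (eStar i x) • e i = x

end Duals

theorem DualBasis.nonempty (A M : Type*) [Ring A] [AddCommGroup M] [Module Aᵐᵒᵖ M]
    [Module.Finite Aᵐᵒᵖ M] [Module.Projective Aᵐᵒᵖ M] : Nonempty (DualBasis A M) := by
  obtain ⟨n, f, g, -, -, hfg⟩ := Module.Finite.exists_comp_eq_id_of_projective Aᵐᵒᵖ M
  refine ⟨⟨n, fun i => f (Pi.single i 1), fun i =>
    ({ toFun := fun x => (g x i).unop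
       map_add' := fun x y => by simp
       map_smul' := fun a x => by simp } : M →ₗ[Aᵐᵒᵖ] A), fun x => ?_⟩⟩
  change ∑ i, op ((g x i).unop) • f (Pi.single i 1) = x
  conv_rhs => rw [← LinearMap.id_apply (R := Aᵐᵒᵖ) x, ← hfg, LinearMap.comp_apply,
    ← Finset.univ_sum_single (g x), map_sum]
  refine Finset.sum_congr rfl fun i _ => ?_
  rw [op_unop, ← map_smul, ← Pi.single_smul, smul_eq_mul, mul_one]

/-! ### Corings, coring endomorphisms and right comodules -/

/-- An `A`-coring structure on the `A`-bimodule `C`. -/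
structure Coring (A C : Type*) [Ring A] [AddCommGroup C] [Module A C] [Module Aᵐᵒᵖ C]
    [SMulCommClass A Aᵐᵒᵖ C] where
  comul : BimodHom A A C (Tens A C C)
  counit : BimodHom A A C A
  coassoc : ∀ c, Tens.assoc A A C C C (Tens.map comul.toRight LinearMap.id (comul c)) =
    Tens.map LinearMap.id comul.toLeft (comul c)
  counit_left : ∀ c, Tens.lid A C (Tens.map counit.toRight LinearMap.id (comul c)) = c
  counit_right : ∀ c, Tens.rid A C (Tens.map LinearMap.id counit.toLeft (comul c)) = c

section Coring

variable {A C : Type*} [Ring A] [AddCommGroup C] [Module A C] [Module Aᵐᵒᵖ C]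
    [SMulCommClass A Aᵐᵒᵖ C]

/-- Endomorphisms of the `A`-coring `𝒞`. -/
structure CoringEnd (𝒞 : Coring A C) extends BimodHom A A C C where
  counit_comp : ∀ c, 𝒞.counit (toBimodHom c) = 𝒞.counit c
  comul_comp : ∀ c, 𝒞.comul (toBimodHom c) =
    Tens.map toBimodHom.toRight toBimodHom.toLeft (𝒞.comul c)

namespace CoringEnd

variable {𝒞 : Coring A C}

instance instFunLike : FunLike (CoringEnd 𝒞) C C where
  coe g := g.toBimodHom
  coe_injective g h e := by
    obtain ⟨g, _, _⟩ := g
    obtain ⟨h, _, _⟩ := h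
    congr
    exact DFunLike.coe_injective e

@[ext] theorem ext {g h : CoringEnd 𝒞} (e : ∀ c, g c = h c) : g = h := DFunLike.ext g h e

@[simp] theorem toBimodHom_apply (g : CoringEnd 𝒞) (c : C) : g.toBimodHom c = g c := rfl

/-- The monoid `End_A(𝒞)` of coring endomorphisms, with composition as product. -/
instance instMonoid : Monoid (CoringEnd 𝒞) where
  mul g h :=
    { toLinearMap := g.toLeft.comp h.toLeft
      map_op_smul' := fun a c => (g.toRight.comp h.toRight).map_smul (op a) c
      counit_comp := fun c => (g.counit_comp (h c)).trans (h.counit_comp c)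
      comul_comp := fun c => by
        refine (g.comul_comp (h c)).trans ?_
        change Tens.map g.toRight g.toLeft (𝒞.comul (h.toBimodHom c)) = _
        rw [h.comul_comp c]
        generalize 𝒞.comul c = z
        induction z using Tens.induction_on with
        | zero => simp
        | tmul x y => rfl
        | add x y hx hy => simp only [map_add, hx, hy] }
  one :=
    { toLinearMap := LinearMap.id
      map_op_smul' := fun _ _ => rfl
      counit_comp := fun _ => rfl
      comul_comp := fun c => by
        change 𝒞.comul c = _
        generalize 𝒞.comul c = z
        induction z using Tens.induction_on with
        | zero => simp
        | tmul x y => rfl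
        | add x y hx hy => rw [map_add, ← hx, ← hy] }
  mul_assoc _ _ _ := rfl
  one_mul _ := rfl
  mul_one _ := rfl

@[simp] theorem mul_apply (g h : CoringEnd 𝒞) (c : C) : (g * h) c = g (h c) := rfl
@[simp] theorem one_apply (c : C) : (1 : CoringEnd 𝒞) c = c := rfl

end CoringEnd

/-- A right `𝒞`-comodule structure on the right `A`-module `X`. -/
structure RightComodule (𝒞 : Coring A C) (X : Type*) [AddCommGroup X] [Module Aᵐᵒᵖ X] where
  coact : X →ₗ[Aᵐᵒᵖ] Tens A X C
  coassoc : ∀ x, Tens.assoc A A X C C (Tens.map coact LinearMap.id (coact x)) =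
    Tens.map LinearMap.id 𝒞.comul.toLeft (coact x)
  counit : ∀ x, Tens.rid A X (Tens.map LinearMap.id 𝒞.counit.toLeft (coact x)) = x

namespace RightComodule

variable {𝒞 : Coring A C} {X Y : Type*} [AddCommGroup X] [Module Aᵐᵒᵖ X]
  [AddCommGroup Y] [Module Aᵐᵒᵖ Y]

/-- The right `A`-linear map `X ⊗_A g`. -/
def mapRight (X : Type*) [AddCommGroup X] [Module Aᵐᵒᵖ X] (g : CoringEnd 𝒞) :
    Tens A X C →ₗ[Aᵐᵒᵖ] Tens A X C where
  toFun := Tens.map LinearMap.id g.toLeft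
  map_add' := map_add _
  map_smul' a z := by
    induction z using Tens.induction_on with
    | zero => simp
    | tmul x c => exact congrArg (Tens.tmul A x) (g.toRight.map_smul a c)
    | add x y hx hy => rw [smul_add, map_add, hx, hy, map_add, smul_add]

@[simp] theorem mapRight_tmul (g : CoringEnd 𝒞) (x : X) (c : C) :
    mapRight X g (Tens.tmul A x c) = Tens.tmul A x (g c) := rfl

/-- The comodule `X_g`, with coaction `(X ⊗_A g) ∘ ρ_X`. -/
def induced (ρ : RightComodule 𝒞 X) (g : CoringEnd 𝒞) : RightComodule 𝒞 X where
  coact := (mapRight X g).comp ρ.coact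
  coassoc x := by
    have h1 : ∀ z : Tens A X C,
        Tens.assoc A A X C C (Tens.map ((mapRight X g).comp ρ.coact) LinearMap.id
          (mapRight X g z)) =
        Tens.map LinearMap.id
          (LinearMap.mk (AddMonoidHom.toAddHom (Tens.map g.toRight g.toLeft)) (by
            intro a w
            change Tens.map g.toRight g.toLeft (a • w) = a • Tens.map g.toRight g.toLeft w
            induction w using Tens.induction_on with
            | zero => simp
            | tmul c d => exact congrArg (fun c => Tens.tmul A c (g d)) (g.toLeft.map_smul a c)
            | add u v hu hv => rw [smul_add, map_add, hu, hv, map_add, smul_add]) :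
            Tens A C C →ₗ[A] Tens A C C)
          (Tens.assoc A A X C C (Tens.map ρ.coact LinearMap.id z)) := by
      intro z
      induction z using Tens.induction_on with
      | zero => simp
      | tmul x c =>
        simp only [mapRight_tmul, Tens.map_tmul, LinearMap.comp_apply, LinearMap.id_apply]
        generalize ρ.coact x = w
        induction w using Tens.induction_on with
        | zero => simp [Tens.zero_tmul]
        | tmul y d => rfl
        | add u v hu hv => simp only [map_add, Tens.add_tmul, hu, hv]
      | add u v hu hv => simp only [map_add, hu, hv]
    rw [LinearMap.comp_apply, h1, ρ.coassoc]
    generalize ρ.coact x = w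
    induction w using Tens.induction_on with
    | zero => simp
    | tmul y d => exact congrArg (Tens.tmul A y) (g.comul_comp d).symm
    | add u v hu hv => simp only [map_add, hu, hv]
  counit x := by
    refine Eq.trans ?_ (ρ.counit x)
    rw [LinearMap.comp_apply]
    generalize ρ.coact x = w
    congr 1
    induction w using Tens.induction_on with
    | zero => simp
    | tmul y d => exact congrArg (Tens.tmul A y) (g.counit_comp d)
    | add u v hu hv => simp only [map_add, hu, hv]

/-- The right `A`-linear map `f` is `𝒞`-colinear. -/
def IsColinear (ρ : RightComodule 𝒞 X) (ρ' : RightComodule 𝒞 Y) (f : X →ₗ[Aᵐᵒᵖ] Y) : Prop :=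
  ∀ x, ρ'.coact (f x) = Tens.map f LinearMap.id (ρ.coact x)

end RightComodule

end Coring

/-! ### The comatrix coring `M^* ⊗_B M` and its comodule `M` -/

section Comatrix

variable (A B M : Type*) [Ring A] [Ring B] [AddCommGroup M] [Module B M] [Module Aᵐᵒᵖ M]
  [SMulCommClass B Aᵐᵒᵖ M]

/-- The `A`-bimodule `M^* ⊗_B M`. -/
abbrev Comatrix : Type _ := Tens B (RightDual A M) M

variable {A M}

theorem DualBasis.sum_smul_eStar (D : DualBasis A M) (f : RightDual A M) :
    ∑ i, f (D.e i) • D.eStar i = f := by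
  ext x
  conv_rhs => rw [← D.sum_eq x]
  have h : f (∑ i, op (D.eStar i x) • D.e i) = ∑ i, f (op (D.eStar i x) • D.e i) :=
    map_sum (show M →ₗ[Aᵐᵒᵖ] A from f) (fun i => op (D.eStar i x) • D.e i) Finset.univ
  rw [RightDual.sum_apply, h]
  simp [RightDual.map_op_smul]

/-- The canonical element is central: `∑ s e_i ⊗ e_i^* = ∑ e_i ⊗ e_i^* s`. -/
theorem DualBasis.sum_comm (D : DualBasis A M) (s : Module.End Aᵐᵒᵖ M) :
    ∑ i, Tens.tmul A (s (D.e i)) (D.eStar i) =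
      ∑ i, Tens.tmul A (D.e i) (RightDual.comp (D.eStar i) s) := by
  have h1 : ∀ i, Tens.tmul A (s (D.e i)) (D.eStar i) =
      ∑ j, Tens.tmul A (D.e j) (D.eStar j (s (D.e i)) • D.eStar i) := fun i => by
    conv_lhs => rw [← D.sum_eq (s (D.e i)), Tens.sum_tmul]
    exact Finset.sum_congr rfl fun j _ => Tens.smul_tmul _ _ _
  rw [Finset.sum_congr rfl fun i _ => h1 i, Finset.sum_comm]
  refine Finset.sum_congr rfl fun j _ => ?_
  rw [← Tens.tmul_sum]
  exact congrArg _ (D.sum_smul_eStar (RightDual.comp (D.eStar j) s))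

variable {B}

/-- For `f` in `M^*` and `u` in `M`, the additive map
`M ⊗_A M^* → (M^* ⊗_B M) ⊗_A (M^* ⊗_B M)`, `m ⊗ h ↦ (f ⊗ m) ⊗ (h ⊗ u)`. -/
def insertMap (f : RightDual A M) (u : M) :
    Tens A M (RightDual A M) →+ Tens A (Comatrix A B M) (Comatrix A B M) :=
  Tens.map
    { toFun := fun m => Tens.tmul B f m
      map_add' := fun m m' => Tens.tmul_add f m m'
      map_smul' := fun _ _ => rfl }
    (Tens.tmulRight u)

variable (B) in
/-- The comultiplication as an additive map. -/
def comulHom (D : DualBasis A M) :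
    Comatrix A B M →+ Tens A (Comatrix A B M) (Comatrix A B M) :=
  Tens.lift
    (AddMonoidHom.mk' (fun f => AddMonoidHom.mk'
        (fun u => ∑ i, Tens.tmul A (Tens.tmul B f (D.e i)) (Tens.tmul B (D.eStar i) u))
        (fun u u' => by simp only [Tens.tmul_add, Finset.sum_add_distrib]))
      (fun f f' => by
        ext u
        change ∑ i, Tens.tmul A (Tens.tmul B (f + f') (D.e i)) (Tens.tmul B (D.eStar i) u) =
          ∑ i, Tens.tmul A (Tens.tmul B f (D.e i)) (Tens.tmul B (D.eStar i) u) +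
          ∑ i, Tens.tmul A (Tens.tmul B f' (D.e i)) (Tens.tmul B (D.eStar i) u)
        simp only [Tens.add_tmul, Finset.sum_add_distrib]))
    (fun f b u => by
      change ∑ i, Tens.tmul A (Tens.tmul B (op b • f) (D.e i)) (Tens.tmul B (D.eStar i) u) =
        ∑ i, Tens.tmul A (Tens.tmul B f (D.e i)) (Tens.tmul B (D.eStar i) (b • u))
      have h := congrArg (insertMap (B := B) f u) (D.sum_comm (Module.toModuleEnd Aᵐᵒᵖ M b))
      rw [map_sum, map_sum] at h
      refine Eq.trans (Finset.sum_congr rfl fun i _ => ?_)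
        (h.trans (Finset.sum_congr rfl fun i _ => ?_))
      · rw [Tens.smul_tmul]; rfl
      · rw [← Tens.smul_tmul (D.eStar i) b u]; rfl)

theorem comulHom_tmul (D : DualBasis A M) (f : RightDual A M) (u : M) :
    comulHom B D (Tens.tmul B f u) =
      ∑ i, Tens.tmul A (Tens.tmul B f (D.e i)) (Tens.tmul B (D.eStar i) u) := rfl

/-- The comultiplication `f ⊗ u ↦ ∑ (f ⊗ e_i) ⊗ (e_i^* ⊗ u)`. -/
def comatrixComul (D : DualBasis A M) :
    BimodHom A A (Comatrix A B M) (Tens A (Comatrix A B M) (Comatrix A B M)) where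
  toFun := comulHom B D
  map_add' := map_add _
  map_smul' a z := by
    induction z using Tens.induction_on with
    | zero => simp
    | tmul f u =>
      rw [RingHom.id_apply, Tens.left_smul_tmul, comulHom_tmul, comulHom_tmul, Finset.smul_sum]; rfl
    | add x y hx hy => rw [smul_add, map_add, hx, hy, map_add, smul_add]
  map_op_smul' a z := by
    change comulHom B D _ = op a • comulHom B D _
    induction z using Tens.induction_on with
    | zero => simp
    | tmul f u => rw [Tens.right_smul_tmul, comulHom_tmul, comulHom_tmul, Finset.smul_sum]; rfl
    | add x y hx hy => rw [smul_add, map_add, hx, hy, map_add, smul_add]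

theorem comatrixComul_tmul (D : DualBasis A M) (f : RightDual A M) (u : M) :
    comatrixComul (B := B) D (Tens.tmul B f u) =
      ∑ i, Tens.tmul A (Tens.tmul B f (D.e i)) (Tens.tmul B (D.eStar i) u) := rfl

variable (A B M) in
/-- The evaluation as an additive map. -/
def counitHom : Comatrix A B M →+ A :=
  Tens.lift (AddMonoidHom.mk' (fun f => AddMonoidHom.mk' (fun u => f u) (RightDual.map_add f))
      (fun f f' => by ext u; exact RightDual.add_apply f f' u))
    (fun _ _ _ => rfl)

variable (A B M) in
/-- The counit `f ⊗ u ↦ f(u)`. -/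
def comatrixCounit : BimodHom A A (Comatrix A B M) A where
  toFun := counitHom A B M
  map_add' := map_add _
  map_smul' a z := by
    induction z using Tens.induction_on with
    | zero => simp
    | tmul f u => rfl
    | add x y hx hy => rw [smul_add, map_add, hx, hy, map_add, smul_add]
  map_op_smul' a z := by
    change counitHom A B M _ = op a • counitHom A B M _
    induction z using Tens.induction_on with
    | zero => simp
    | tmul f u => exact RightDual.map_op_smul f a u
    | add x y hx hy => rw [smul_add, map_add, hx, hy, map_add, smul_add]

@[simp] theorem comatrixCounit_tmul (f : RightDual A M) (u : M) :
    comatrixCounit A B M (Tens.tmul B f u) = f u := rfl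

variable (B) in
/-- The comatrix `A`-coring `M^* ⊗_B M`. -/
def comatrixCoring (D : DualBasis A M) : Coring A (Comatrix A B M) where
  comul := comatrixComul D
  counit := comatrixCounit A B M
  coassoc z := by
    induction z using Tens.induction_on with
    | zero => simp only [BimodHom.map_zero, map_zero]
    | tmul f u =>
      rw [comatrixComul_tmul, map_sum, map_sum, map_sum]
      simp only [Tens.map_tmul, BimodHom.toRight_apply, BimodHom.toLeft_apply,
        comatrixComul_tmul, Tens.sum_tmul, Tens.tmul_sum, map_sum, LinearMap.id_apply,
        Tens.assoc_tmul]
      rw [Finset.sum_comm]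
    | add x y hx hy => simp only [BimodHom.map_add, map_add, hx, hy]
  counit_left z := by
    induction z using Tens.induction_on with
    | zero => simp only [BimodHom.map_zero, map_zero]
    | tmul f u =>
      rw [comatrixComul_tmul, map_sum, map_sum]
      simp only [Tens.map_tmul, BimodHom.toRight_apply, comatrixCounit_tmul, LinearMap.id_apply,
        Tens.lid_tmul, Tens.left_smul_tmul]
      rw [← Tens.sum_tmul, D.sum_smul_eStar]
    | add x y hx hy => simp only [BimodHom.map_add, map_add, hx, hy]
  counit_right z := by
    induction z using Tens.induction_on with
    | zero => simp only [BimodHom.map_zero, map_zero]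
    | tmul f u =>
      rw [comatrixComul_tmul, map_sum, map_sum]
      simp only [Tens.map_tmul, BimodHom.toLeft_apply, comatrixCounit_tmul, LinearMap.id_apply,
        Tens.rid_tmul, Tens.right_smul_tmul]
      rw [← Tens.tmul_sum, D.sum_eq]
    | add x y hx hy => simp only [BimodHom.map_add, map_add, hx, hy]

variable (B) in
/-- The right comodule `M` over the comatrix coring, with coaction `u ↦ ∑ e_i ⊗ (e_i^* ⊗ u)`. -/
def canonicalComodule (D : DualBasis A M) : RightComodule (comatrixCoring B D) M where
  coact :=
    { toFun := fun u => ∑ i, Tens.tmul A (D.e i) (Tens.tmul B (D.eStar i) u)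
      map_add' := fun u v => by simp only [Tens.tmul_add, Finset.sum_add_distrib]
      map_smul' := fun a u => by
        rw [Finset.smul_sum]; rfl }
  coassoc u := by
    change Tens.assoc _ _ _ _ _ (Tens.map _ _
        (∑ i, Tens.tmul A (D.e i) (Tens.tmul B (D.eStar i) u))) =
      Tens.map _ (comatrixComul D).toLeft (∑ i, Tens.tmul A (D.e i) (Tens.tmul B (D.eStar i) u))
    rw [map_sum, map_sum, map_sum]
    simp only [Tens.map_tmul, LinearMap.coe_mk, AddHom.coe_mk, BimodHom.toLeft_apply,
        comatrixComul_tmul, Tens.sum_tmul, Tens.tmul_sum, map_sum, LinearMap.id_apply,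
        Tens.assoc_tmul]
    rw [Finset.sum_comm]
  counit u := by
    change Tens.rid _ _ (Tens.map _ (comatrixCounit A B M).toLeft
      (∑ i, Tens.tmul A (D.e i) (Tens.tmul B (D.eStar i) u))) = u
    rw [map_sum, map_sum]
    simp only [Tens.map_tmul, BimodHom.toLeft_apply, comatrixCounit_tmul, LinearMap.id_apply,
        Tens.rid_tmul]
    exact D.sum_eq u

theorem canonicalComodule_coact (D : DualBasis A M) (u : M) :
    (canonicalComodule B D).coact u = ∑ i, Tens.tmul A (D.e i) (Tens.tmul B (D.eStar i) u) := rfl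

/-- The coaction of `M` is left `B`-linear. -/
theorem canonicalComodule_coact_smul (D : DualBasis A M) (b : B) (u : M) :
    (canonicalComodule B D).coact (b • u) =
      Tens.map (Module.toModuleEnd Aᵐᵒᵖ M b) LinearMap.id ((canonicalComodule B D).coact u) := by
  have h := congrArg (Tens.map (LinearMap.id : M →ₗ[Aᵐᵒᵖ] M) (Tens.tmulRight (T := B) u))
    (D.sum_comm (Module.toModuleEnd Aᵐᵒᵖ M b))
  rw [map_sum, map_sum] at h
  rw [canonicalComodule_coact, canonicalComodule_coact, map_sum]
  refine Eq.trans (Finset.sum_congr rfl fun i _ => ?_) h.symm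
  rw [← Tens.smul_tmul (D.eStar i) b u]; rfl

end Comatrix

/-! ### Sub-bimodules of a ring extension -/

section SubBimodule

/-- The ring extension `B → S`, `b ↦ b • 1`, is given by a left `B`-module structure on `S` with
`(b s) t = b (s t)`.  A `SubBimodule B S` is a `B`-sub-bimodule of `S`, an element of `I_B(S)`. -/
@[ext] structure SubBimodule (B S : Type*) [Ring B] [Ring S] [Module B S] [IsScalarTower B S S]
    extends AddSubgroup S where
  smul_mem : ∀ (b : B) (x : S), x ∈ toAddSubgroup → b • x ∈ toAddSubgroup
  mul_smul_one_mem : ∀ (b : B) (x : S), x ∈ toAddSubgroup → x * (b • (1 : S)) ∈ toAddSubgroup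

namespace SubBimodule

variable {B S : Type*} [Ring B] [Ring S] [Module B S] [IsScalarTower B S S]

instance instSetLike : SetLike (SubBimodule B S) S where
  coe I := I.carrier
  coe_injective I J h := by
    ext x; exact Set.ext_iff.1 h x

instance instAddSubgroupClass : AddSubgroupClass (SubBimodule B S) S where
  add_mem {I} := I.add_mem
  zero_mem {I} := I.zero_mem
  neg_mem {I} := I.neg_mem

theorem mem_toAddSubgroup {I : SubBimodule B S} {x : S} : x ∈ I.toAddSubgroup ↔ x ∈ I := Iff.rfl

/-- The right `B`-action on `I ⊆ S`. -/
instance instModuleRight (I : SubBimodule B S) : Module Bᵐᵒᵖ I where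
  smul b x := ⟨x.1 * (b.unop • (1 : S)), I.mul_smul_one_mem _ _ x.2⟩
  one_smul x := Subtype.ext (by change x.1 * ((1 : Bᵐᵒᵖ).unop • (1 : S)) = x.1; simp)
  mul_smul a b x := Subtype.ext (by
    change x.1 * ((a * b).unop • (1 : S)) = x.1 * (b.unop • (1 : S)) * (a.unop • (1 : S))
    rw [mul_assoc, smul_one_mul, smul_smul, unop_mul])
  smul_zero a := Subtype.ext (zero_mul _)
  smul_add a x y := Subtype.ext (add_mul _ _ _)
  add_smul a b x := Subtype.ext (by
    change x.1 * ((a + b).unop • (1 : S)) = x.1 * (a.unop • (1 : S)) + x.1 * (b.unop • (1 : S))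
    rw [unop_add, add_smul, mul_add])
  zero_smul x := Subtype.ext (by
    change x.1 * ((0 : Bᵐᵒᵖ).unop • (1 : S)) = 0
    simp)

theorem coe_op_smul {I : SubBimodule B S} (b : B) (x : I) :
    ((op b • x : I) : S) = x * (b • (1 : S)) := rfl

/-- The monoid `I_B(S)`: the product `I J` is the additive subgroup generated by the products
`x y`, and the unit is the image of `B`. -/
instance instMonoid : Monoid (SubBimodule B S) where
  mul I J :=
    { toAddSubgroup := I.toAddSubgroup * J.toAddSubgroup
      smul_mem := fun b x hx => by
        refine AddSubmonoid.mul_induction_on hx (fun m hm n hn => ?_) (fun x y hx hy => ?_)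
        · rw [← smul_mul_assoc]
          exact AddSubmonoid.mul_mem_mul (I.smul_mem b m hm) hn
        · rw [smul_add]
          exact AddSubgroup.add_mem _ hx hy
      mul_smul_one_mem := fun b x hx => by
        refine AddSubmonoid.mul_induction_on hx (fun m hm n hn => ?_) (fun x y hx hy => ?_)
        · rw [mul_assoc]
          exact AddSubmonoid.mul_mem_mul hm (J.mul_smul_one_mem b n hn)
        · rw [add_mul]
          exact AddSubgroup.add_mem _ hx hy }
  one :=
    { toAddSubgroup := (RingHom.smulOneHom : B →+* S).toAddMonoidHom.range
      smul_mem := by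
        rintro b _ ⟨c, rfl⟩
        exact ⟨b * c, by simp [mul_smul]⟩
      mul_smul_one_mem := by
        rintro b _ ⟨c, rfl⟩
        exact ⟨c * b, by simp [mul_smul]⟩ }
  mul_assoc I J K := by
    refine SetLike.ext' ?_
    exact congrArg (fun N : AddSubmonoid S => (N : Set S))
      (mul_assoc I.toAddSubmonoid J.toAddSubmonoid K.toAddSubmonoid)
  one_mul I := by
    refine SetLike.ext fun x => ⟨fun hx => ?_, fun hx => ?_⟩
    · refine AddSubmonoid.mul_induction_on hx ?_ (fun x y hx hy => add_mem hx hy)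
      rintro _ ⟨b, rfl⟩ n hn
      change (b • (1 : S)) * n ∈ I
      rw [smul_one_mul]
      exact I.smul_mem b n hn
    · rw [← one_mul x]
      exact AddSubmonoid.mul_mem_mul ⟨1, by simp⟩ hx
  mul_one I := by
    refine SetLike.ext fun x => ⟨fun hx => ?_, fun hx => ?_⟩
    · refine AddSubmonoid.mul_induction_on hx ?_ (fun x y hx hy => add_mem hx hy)
      rintro m hm _ ⟨b, rfl⟩
      exact I.mul_smul_one_mem b m hm
    · rw [← mul_one x]
      exact AddSubmonoid.mul_mem_mul hx ⟨1, by simp⟩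

theorem mul_mem_mul {I J : SubBimodule B S} {x y : S} (hx : x ∈ I) (hy : y ∈ J) :
    x * y ∈ I * J := AddSubmonoid.mul_mem_mul hx hy

theorem mul_induction {I J : SubBimodule B S} {p : S → Prop} {z : S} (hz : z ∈ I * J)
    (hm : ∀ x ∈ I, ∀ y ∈ J, p (x * y)) (ha : ∀ x y, p x → p y → p (x + y)) : p z :=
  AddSubmonoid.mul_induction_on hz hm ha

theorem mem_one {x : S} : x ∈ (1 : SubBimodule B S) ↔ ∃ b : B, b • (1 : S) = x := Iff.rfl

/-- The multiplication map `m : I ⊗_B S → S`. -/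
def mulMap (I : SubBimodule B S) : Tens B I S →+ S :=
  Tens.lift (AddMonoidHom.mk' (fun x => AddMonoidHom.mulLeft (x : S))
      (fun x y => by ext s; exact add_mul _ _ _))
    (fun x b s => by
      change (x : S) * (b • (1 : S)) * s = x * (b • s)
      rw [mul_assoc, smul_one_mul])

@[simp] theorem mulMap_tmul (I : SubBimodule B S) (x : I) (s : S) :
    mulMap I (Tens.tmul B x s) = x * s := rfl

variable (B S) in
/-- The submonoid `I_B^r(S)` of all `I` such that `m : I ⊗_B S → S` is an isomorphism. -/
def rightInvertible : Submonoid (SubBimodule B S) where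
  carrier := {I | Function.Bijective (mulMap I)}
  one_mem' := by
    have key : ∀ z : Tens B (1 : SubBimodule B S) S,
        z = Tens.tmul B (⟨1, mem_one.2 ⟨1, one_smul _ _⟩⟩ : (1 : SubBimodule B S)) (mulMap _ z) := by
      intro z
      induction z using Tens.induction_on with
      | zero => rw [map_zero, Tens.tmul_zero]
      | tmul x s =>
        obtain ⟨_, b, rfl⟩ := x
        rw [mulMap_tmul]
        change _ = Tens.tmul B _ ((b • (1 : S)) * s)
        rw [smul_one_mul, ← Tens.smul_tmul]
        congr 1
        refine Subtype.ext ?_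
        rw [coe_op_smul, one_mul]
        rfl
      | add x y hx hy => rw [map_add, Tens.tmul_add, ← hx, ← hy]
    refine ⟨fun z w h => ?_, fun s => ⟨Tens.tmul B ⟨1, mem_one.2 ⟨1, one_smul _ _⟩⟩ s, one_mul s⟩⟩
    rw [key z, key w, h]
  mul_mem' {I J} hI hJ := by
    obtain ⟨hI, hI'⟩ := hI
    obtain ⟨hJ, hJ'⟩ := hJ
    let θ : I → (Tens B J S →+ Tens B (I * J : SubBimodule B S) S) := fun x =>
      Tens.map { toFun := fun y : J => (⟨x * y, mul_mem_mul x.2 y.2⟩ : (I * J : SubBimodule B S))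
                 map_add' := fun y y' => Subtype.ext (mul_add _ _ _)
                 map_smul' := fun b y => Subtype.ext (mul_assoc _ _ _).symm }
        LinearMap.id
    have θ_tmul : ∀ (x : I) (y : J) (s : S), θ x (Tens.tmul B y s) =
      Tens.tmul B (⟨x * y, mul_mem_mul x.2 y.2⟩ : (I * J : SubBimodule B S)) s := fun _ _ _ => rfl
    have θ_add : ∀ x x' z, θ (x + x') z = θ x z + θ x' z := by
      intro x x' z
      induction z using Tens.induction_on with
      | zero => simp
      | tmul y s =>
        rw [θ_tmul, θ_tmul, θ_tmul, ← Tens.add_tmul]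
        congr 1
        exact Subtype.ext (add_mul _ _ _)
      | add u v hu hv => rw [map_add, hu, hv, map_add, map_add]; abel
    have mJ_smul : ∀ (b : B) z, ∃ w, mulMap J w = b • mulMap J z ∧
        ∀ x : I, θ (op b • x) z = θ x w := by
      intro b z
      induction z using Tens.induction_on with
      | zero => exact ⟨0, by simp, by simp⟩
      | tmul y s =>
        refine ⟨Tens.tmul B ⟨b • y, J.smul_mem b y y.2⟩ s, ?_, fun x => ?_⟩
        · rw [mulMap_tmul, mulMap_tmul, smul_mul_assoc]
        · rw [θ_tmul, θ_tmul]
          congr 1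
          refine Subtype.ext ?_
          change (x : S) * (b • (1 : S)) * y = x * (b • (y : S))
          rw [mul_assoc, smul_one_mul]
      | add u v hu hv =>
        obtain ⟨u', h1, h2⟩ := hu
        obtain ⟨v', h3, h4⟩ := hv
        exact ⟨u' + v', by rw [map_add, h1, h3, map_add, smul_add],
          fun x => by rw [map_add, map_add, h2, h4]⟩
    let e : Tens B J S ≃+ S := AddEquiv.ofBijective (mulMap J) ⟨hJ, hJ'⟩
    have e_symm : ∀ s, mulMap J (e.symm s) = s := fun s => e.apply_symm_apply s
    let φ : Tens B I S →+ Tens B (I * J : SubBimodule B S) S :=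
      Tens.lift (AddMonoidHom.mk' (fun x => (θ x).comp e.symm.toAddMonoidHom)
          (fun x x' => by ext s; exact θ_add x x' _))
        (fun x b s => by
          change θ (op b • x) (e.symm s) = θ x (e.symm (b • s))
          obtain ⟨w, hw, hw'⟩ := mJ_smul b (e.symm s)
          rw [hw']
          congr 1
          apply hJ
          rw [hw, e_symm, e_symm])
    have φ_surj : Function.Surjective φ := by
      intro z
      induction z using Tens.induction_on with
      | zero => exact ⟨0, map_zero _⟩
      | tmul w s =>
        obtain ⟨w, hw⟩ := w
        suffices h : ∃ h' : w ∈ I * J, ∃ z, φ z = Tens.tmul B (⟨w, h'⟩ : (I * J : SubBimodule B S)) s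
          from h.2
        refine mul_induction (p := fun w => ∃ h' : w ∈ I * J, ∃ z,
          φ z = Tens.tmul B (⟨w, h'⟩ : (I * J : SubBimodule B S)) s) hw (fun x hx y hy => ⟨mul_mem_mul hx hy,
          Tens.tmul B (⟨x, hx⟩ : I) (y * s), ?_⟩) ?_
        · change θ ⟨x, hx⟩ (e.symm (y * s)) = _
          have : e.symm (y * s) = Tens.tmul B (⟨y, hy⟩ : J) s := by
            apply hJ; rw [e_symm, mulMap_tmul]
          rw [this, θ_tmul]
        · rintro x y ⟨hx, u, hu⟩ ⟨hy, v, hv⟩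
          refine ⟨add_mem hx hy, u + v, ?_⟩
          rw [map_add, hu, hv, ← Tens.add_tmul]
          rfl
      | add u v hu hv =>
        obtain ⟨u', rfl⟩ := hu
        obtain ⟨v', rfl⟩ := hv
        exact ⟨u' + v', map_add _ _ _⟩
    have hθ : ∀ (x : I) z, mulMap (I * J) (θ x z) = x * mulMap J z := by
      intro x z
      induction z using Tens.induction_on with
      | zero => simp
      | tmul y s => rw [θ_tmul, mulMap_tmul, mulMap_tmul, ← mul_assoc]
      | add u v hu hv => rw [map_add, map_add, hu, hv, map_add, mul_add]
    have hφ : ∀ z, mulMap (I * J) (φ z) = mulMap I z := by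
      intro z
      induction z using Tens.induction_on with
      | zero => simp
      | tmul x s =>
        change mulMap (I * J) (θ x (e.symm s)) = _
        rw [hθ, e_symm, mulMap_tmul]
      | add u v hu hv => rw [map_add, map_add, hu, hv, map_add]
    refine ⟨fun z w h => ?_, fun s => ?_⟩
    · obtain ⟨z, rfl⟩ := φ_surj z
      obtain ⟨w, rfl⟩ := φ_surj w
      rw [hφ, hφ] at h
      rw [hI h]
    · obtain ⟨z, hz⟩ := hI' s
      exact ⟨φ z, (hφ z).trans hz⟩

/-- For `I ∈ I_B^r(S)`, the multiplication `m : I ⊗_B S → S` as an additive isomorphism. -/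
noncomputable def mulEquiv (I : rightInvertible B S) : Tens B (I : SubBimodule B S) S ≃+ S :=
  AddEquiv.ofBijective (mulMap I.1) I.2

theorem mem_rightInvertible {I : SubBimodule B S} :
    I ∈ rightInvertible B S ↔ Function.Bijective (mulMap I) := Iff.rfl

end SubBimodule

end SubBimodule

/-! ### The map `g ↦ Hom_𝒞(M, M_g)` -/

section Main

variable {A B M : Type*} [Ring A] [Ring B] [AddCommGroup M] [Module B M] [Module Aᵐᵒᵖ M]
  [SMulCommClass B Aᵐᵒᵖ M]

/-- The ring extension `B → S = End(M_A)`: `(b s)(m) = b s(m)`. -/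
instance instModuleEnd : Module B (Module.End Aᵐᵒᵖ M) :=
  haveI : SMulCommClass Aᵐᵒᵖ B M := SMulCommClass.symm _ _ _
  LinearMap.module

theorem end_smul_apply (b : B) (s : Module.End Aᵐᵒᵖ M) (m : M) : (b • s) m = b • s m := rfl

instance instIsScalarTowerEnd :
    IsScalarTower B (Module.End Aᵐᵒᵖ M) (Module.End Aᵐᵒᵖ M) where
  smul_assoc _ _ _ := rfl

theorem map_comp_id {C : Type*} [AddCommGroup C] [Module A C] (s t : Module.End Aᵐᵒᵖ M)
    (z : Tens A M C) :
    Tens.map (s * t) LinearMap.id z = Tens.map s LinearMap.id (Tens.map t LinearMap.id z) := by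
  induction z using Tens.induction_on with
  | zero => simp
  | tmul m c => rfl
  | add x y hx hy => simp only [map_add, hx, hy]

/-- The `B`-sub-bimodule `Hom_𝒞(M, M_g)` of `S = End(M_A)`, for an endomorphism `g` of the
comatrix coring `𝒞 = M^* ⊗_B M`. -/
def homInduced (D : DualBasis A M) (g : CoringEnd (comatrixCoring B D)) :
    SubBimodule B (Module.End Aᵐᵒᵖ M) where
  carrier := {t | RightComodule.IsColinear (canonicalComodule B D)
    ((canonicalComodule B D).induced g) t}
  add_mem' {s t} hs ht := fun x => by
    rw [LinearMap.add_apply, map_add, hs x, ht x]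
    generalize (canonicalComodule B D).coact x = z
    induction z using Tens.induction_on with
    | zero => simp
    | tmul m c => exact (Tens.add_tmul _ _ _).symm
    | add x y hx hy => rw [map_add, map_add, map_add, ← hx, ← hy]; abel
  zero_mem' := fun x => by
    rw [LinearMap.zero_apply, map_zero]
    generalize (canonicalComodule B D).coact x = z
    induction z using Tens.induction_on with
    | zero => simp
    | tmul m c => exact (Tens.zero_tmul _).symm
    | add x y hx hy => rw [map_add, ← hx, ← hy, add_zero]
  neg_mem' {t} ht := fun x => by
    rw [LinearMap.neg_apply, map_neg, ht x, neg_eq_iff_add_eq_zero]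
    generalize (canonicalComodule B D).coact x = z
    induction z using Tens.induction_on with
    | zero => simp
    | tmul m c =>
      rw [Tens.map_tmul, Tens.map_tmul, ← Tens.add_tmul, LinearMap.neg_apply, add_neg_cancel,
        Tens.zero_tmul]
    | add x y hx hy =>
      rw [map_add, map_add, add_add_add_comm, hx, hy, add_zero]
  smul_mem b t ht := fun x => by
    have hb : ∀ y : M, ((canonicalComodule B D).induced g).coact (b • y) =
        Tens.map (Module.toModuleEnd Aᵐᵒᵖ M b) LinearMap.id
          (((canonicalComodule B D).induced g).coact y) := fun y => by
      change RightComodule.mapRight M g ((canonicalComodule B D).coact (b • y)) =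
        Tens.map _ _ (RightComodule.mapRight M g ((canonicalComodule B D).coact y))
      rw [canonicalComodule_coact_smul]
      generalize (canonicalComodule B D).coact y = z
      induction z using Tens.induction_on with
      | zero => simp
      | tmul m c => rfl
      | add x y hx hy => simp only [map_add, hx, hy]
    rw [end_smul_apply, hb, ht x, ← map_comp_id]
    rfl
  mul_smul_one_mem b t ht := fun x => by
    change ((canonicalComodule B D).induced g).coact (t (b • x)) = _
    rw [ht (b • x), canonicalComodule_coact_smul, ← map_comp_id]
    rfl

end Main

end ComatrixCoring

/-! Write `S = End(M_A)`. The dual basis identifies `S` with `M ⊗_A M^*`, so `S ⊗_B S` is a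
two-sided enlargement of `M^* ⊗_B M`. An element `c = ∑ t_k ⊗ s_k` of `S ⊗_B S` acts by `f ⊗ u ↦ ∑ f
t_k ⊗ s_k u` (`act`), and every bimodule endomorphism `g` of the comatrix coring arises from exactly
one such `c` (`act_coeff`, `eq_of_act_eq`). Under this dictionary, compatibility of `g` with the
counit gives `∑ t_k s_k = 1` (`mulHom_coeff`), compatibility with the comultiplication gives the
cocycle condition (`coeff_isCocycle`), and `Hom_𝒞(M, M_g)` becomes `I_c = {t | c t = t ⊗ 1}`
(`mem_homInduced`). The rest concerns the ring extension `B → S` alone.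

From `c` to `I_c`: on `I_c ⊗_B S` the map `z ↦ c m(z)` is the canonical map to `S ⊗_B S`. Hence `m`
is bijective as soon as that canonical map is injective and `c` lies in its image
(`mulMap_bijective`). The cocycle condition puts `c` in the equalizer of `s ↦ c s` and `s ↦ s ⊗ 1`
tensored with `S`, while `I_c` is the equalizer before tensoring. So it suffices that `- ⊗_B S`
preserves this equalizer. It does if `_B S` is flat, which follows from flatness of `_B M`; it also
does if `B → S` splits as a bimodule map, which follows from separability, since `I_c` is then a
direct summand of `S`.

From `I` to `c`: take for `c` the image of `m⁻¹(1)` (`unitCoeff`). Bijectivity of `m` gives `c m(z)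
= z` in `S ⊗_B S`, and from this come `c t = t ⊗ 1` on `I`, centrality over `B` and the cocycle
condition. Conversely `c` is the only element with `c t = t ⊗ 1` on `I` (`eq_unitCoeff`). If `c t =
t ⊗ 1` for some `t` in `S`, then the class of `t` in `S / I` satisfies `t ⊗ 1 = 0`, and either
hypothesis makes `n ↦ n ⊗ 1` injective, so `t ∈ I` (`mem_of_op_smul_unitCoeff`). Thus `I = I_c`.

Multiplicativity needs only one inclusion. Composing colinear maps gives `I_h I_g ⊆ I_{gh}`; the
left side is right invertible, and a right invertible sub-bimodule contained in `I_{gh}` has the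
same `c` and is therefore equal to it (`eq_homInduced_of_le`). -/

namespace ComatrixCoring

open MulOpposite
open scoped TensorProduct Pointwise

/-! ### Further properties of the tensor product -/

namespace Tens

section

variable {R M N : Type*} [Ring R] [AddCommGroup M] [Module Rᵐᵒᵖ M]
  [AddCommGroup N] [Module R N] {M' : Type*} [AddCommGroup M'] [Module Rᵐᵒᵖ M']
  {M'' : Type*} [AddCommGroup M''] [Module Rᵐᵒᵖ M'']
  {N' : Type*} [AddCommGroup N'] [Module R N'] {N'' : Type*} [AddCommGroup N''] [Module R N'']

theorem map_map (f' : M' →ₗ[Rᵐᵒᵖ] M'') (g' : N' →ₗ[R] N'') (f : M →ₗ[Rᵐᵒᵖ] M') (g : N →ₗ[R] N')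
    (z : Tens R M N) : map f' g' (map f g z) = map (f'.comp f) (g'.comp g) z := by
  induction z using induction_on with
  | zero => simp
  | tmul m n => rfl
  | add x y hx hy => simp only [map_add, hx, hy]

theorem map_id_id (z : Tens R M N) : map LinearMap.id LinearMap.id z = z := by
  induction z using induction_on with
  | zero => simp
  | tmul m n => rfl
  | add x y hx hy => simp only [map_add, hx, hy]

theorem map_sub_left (f g : M →ₗ[Rᵐᵒᵖ] M') (h : N →ₗ[R] N') (z : Tens R M N) :
    map (f - g) h z = map f h z - map g h z := by
  induction z using induction_on with
  | zero => simp
  | tmul m n =>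
    rw [map_tmul, map_tmul, map_tmul, eq_sub_iff_add_eq, ← add_tmul, LinearMap.sub_apply,
      sub_add_cancel]
  | add x y hx hy => rw [map_add, map_add, map_add, hx, hy]; abel

theorem map_right_smul {K : Type*} [Ring K] [Module Kᵐᵒᵖ N] [SMulCommClass R Kᵐᵒᵖ N]
    (f : M →ₗ[Rᵐᵒᵖ] M') (k : K) (z : Tens R M N) :
    map f LinearMap.id (op k • z) = op k • map f (LinearMap.id : N →ₗ[R] N) z := by
  induction z using induction_on with
  | zero => simp
  | tmul m n => rfl
  | add x y hx hy => simp only [map_add, smul_add, hx, hy]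

/-- Right exactness of the tensor product. -/
theorem exists_map_subtype_eq (p : Submodule Rᵐᵒᵖ M) (z : Tens R M N)
    (hz : map p.mkQ (LinearMap.id : N →ₗ[R] N) z = 0) :
    ∃ w : Tens R p N, map p.subtype LinearMap.id w = z := by
  let H : AddSubgroup (Tens R M N) := (map p.subtype (LinearMap.id : N →ₗ[R] N)).range
  let q : Tens R M N →+ Tens R M N ⧸ H := QuotientAddGroup.mk' H
  have hq : ∀ m ∈ p, ∀ n, q (tmul R m n) = 0 := fun m hm n =>
    (QuotientAddGroup.eq_zero_iff _).2 ⟨tmul R ⟨m, hm⟩ n, rfl⟩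
  -- The projection `q` onto the cokernel of `p ⊗ N → M ⊗ N` factors through `(M ⧸ p) ⊗ N`, so the
  -- kernel of `M ⊗ N → (M ⧸ p) ⊗ N` lies in the kernel `H` of `q`.
  let k : M ⧸ p →+ N →+ Tens R M N ⧸ H :=
    QuotientAddGroup.lift p.toAddSubgroup (((tmulHom R M N).compr₂ q))
      (fun m hm => by ext n; exact hq m hm n)
  have hk : ∀ m n, k (p.mkQ m) n = q (tmul R m n) := fun _ _ => rfl
  let l : Tens R (M ⧸ p) N →+ Tens R M N ⧸ H := lift k (fun x r n => by
    obtain ⟨m, rfl⟩ := p.mkQ_surjective x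
    rw [← map_smul, hk, hk, smul_tmul])
  have hl : ∀ z, l (map p.mkQ LinearMap.id z) = q z := by
    intro z
    induction z using induction_on with
    | zero => simp
    | tmul m n => rfl
    | add x y hx hy => simp only [map_add, hx, hy]
  have h0 : q z = 0 := by rw [← hl, hz, map_zero]
  exact (QuotientAddGroup.eq_zero_iff _).1 h0

end

end Tens

/-! ### Right `S`-linearity of the multiplication map -/

namespace SubBimodule

variable {B S : Type*} [Ring B] [Ring S] [Module B S] [IsScalarTower B S S]

theorem mulMap_op_smul (I : SubBimodule B S) (s : S) (z : Tens B I S) :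
    mulMap I (op s • z) = mulMap I z * s := by
  induction z using Tens.induction_on with
  | zero => simp
  | tmul x y => exact (mul_assoc _ _ _).symm
  | add x y hx hy => rw [smul_add, map_add, map_add, hx, hy, add_mul]

theorem mulMap_mulEquiv_symm (I : rightInvertible B S) (s : S) :
    mulMap I.1 ((mulEquiv I).symm s) = s :=
  (mulEquiv I).apply_symm_apply s

end SubBimodule

/-! ### Ring extensions and the coefficients of coring endomorphisms -/

/-- The right `B`-action on `S` is the one given by the ring homomorphism `b ↦ b • 1`. -/
class IsRingExtension (B S : Type*) [Ring B] [Ring S] [Module B S] [Module Bᵐᵒᵖ S] : Prop where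
  op_smul_eq : ∀ (b : B) (x : S), op b • x = x * (b • (1 : S))

namespace RingExtension

theorem op_smul_eq {B S : Type*} [Ring B] [Ring S] [Module B S] [Module Bᵐᵒᵖ S]
    [IsRingExtension B S] (b : B) (x : S) : op b • x = x * (b • (1 : S)) :=
  IsRingExtension.op_smul_eq b x

section

variable {B S : Type*} [Ring B] [Ring S] [Module B S] [IsScalarTower B S S] [Module Bᵐᵒᵖ S]
  [IsRingExtension B S]

instance instSMulCommClass : SMulCommClass B Bᵐᵒᵖ S where
  smul_comm b c x := by
    rw [← op_unop c, op_smul_eq, op_smul_eq, smul_mul_assoc]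

instance instSMulCommClassSelf : SMulCommClass S Bᵐᵒᵖ S where
  smul_comm s c x := by
    rw [← op_unop c, op_smul_eq, op_smul_eq, smul_eq_mul, smul_eq_mul, mul_assoc]

/-- Reconciles the two right actions on `S ⊗_B S`, that of `B` and that of `S` restricted along `B →
S`. -/
theorem op_smul_tens (b : B) (z : Tens B S S) : op b • z = op (b • (1 : S)) • z := by
  induction z using Tens.induction_on with
  | zero => simp
  | tmul x y =>
    rw [Tens.right_smul_tmul, Tens.right_smul_tmul, op_smul_eq, op_smul_eq_mul]
  | add x y hx hy => rw [smul_add, smul_add, hx, hy]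

/-- The map `S → S ⊗_B S`, `s ↦ s ⊗ 1`. -/
def unitRight (B S : Type*) [Ring B] [Ring S] [Module B S] [IsScalarTower B S S] [Module Bᵐᵒᵖ S]
    [IsRingExtension B S] : S →ₗ[Bᵐᵒᵖ] Tens B S S where
  toFun s := Tens.tmul B s 1
  map_add' x y := Tens.add_tmul x y 1
  map_smul' b s := by
    rw [RingHom.id_apply, ← op_unop b, Tens.smul_tmul, Tens.right_smul_tmul, op_smul_eq, one_mul]

@[simp] theorem unitRight_apply (s : S) : unitRight B S s = Tens.tmul B s 1 := rfl

/-- The map `S → S ⊗_B S`, `s ↦ c s`. -/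
def mulRight (c : Tens B S S) : S →ₗ[Bᵐᵒᵖ] Tens B S S where
  toFun s := op s • c
  map_add' x y := by rw [op_add, add_smul]
  map_smul' b s := by
    rw [RingHom.id_apply, ← op_unop b, op_smul_eq, op_mul, mul_smul, op_smul_tens]

@[simp] theorem mulRight_apply (c : Tens B S S) (s : S) : mulRight c s = op s • c := rfl

/-- The cocycle condition `∑ t_k ⊗ s_k t_l ⊗ s_l = ∑ t_k ⊗ 1 ⊗ s_k`. -/
def IsCocycle (c : Tens B S S) : Prop :=
  Tens.map (mulRight c) LinearMap.id c = Tens.map (unitRight B S) (LinearMap.id : S →ₗ[B] S) c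

/-- The multiplication `S ⊗_B S → S`. -/
def mulHom (B S : Type*) [Ring B] [Ring S] [Module B S] [IsScalarTower B S S] [Module Bᵐᵒᵖ S]
    [IsRingExtension B S] : Tens B S S →+ S :=
  Tens.lift AddMonoidHom.mul (fun x b s => by
    change (op b • x) * s = x * (b • s)
    rw [op_smul_eq, mul_assoc, smul_one_mul])

@[simp] theorem mulHom_tmul (x y : S) : mulHom B S (Tens.tmul B x y) = x * y := rfl

/-- The inclusion of a sub-bimodule. -/
def incl (I : SubBimodule B S) : I →ₗ[Bᵐᵒᵖ] S where
  toFun x := x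
  map_add' _ _ := rfl
  map_smul' b x := (op_smul_eq b.unop (x : S)).symm

@[simp] theorem incl_apply (I : SubBimodule B S) (x : I) : incl I x = x := rfl

/-- The canonical map `I ⊗_B S → S ⊗_B S`. -/
def inclTens (I : SubBimodule B S) : Tens B I S →+ Tens B S S := Tens.map (incl I) LinearMap.id

@[simp] theorem inclTens_tmul (I : SubBimodule B S) (x : I) (s : S) :
    inclTens I (Tens.tmul B x s) = Tens.tmul B (x : S) s := rfl

theorem mulHom_inclTens (I : SubBimodule B S) (z : Tens B I S) :
    mulHom B S (inclTens I z) = SubBimodule.mulMap I z := by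
  induction z using Tens.induction_on with
  | zero => simp
  | tmul x y => rfl
  | add x y hx hy => simp only [map_add, hx, hy]

/-- If `c t = t ⊗ 1` for all `t ∈ I`, then `c m(z)` is the image of `z` for all `z ∈ I ⊗_B S`. -/
theorem op_mulMap_smul {c : Tens B S S} {I : SubBimodule B S}
    (hI : ∀ t ∈ I, op t • c = Tens.tmul B t 1) (z : Tens B I S) :
    op (SubBimodule.mulMap I z) • c = inclTens I z := by
  induction z using Tens.induction_on with
  | zero => simp
  | tmul x y =>
    rw [SubBimodule.mulMap_tmul, op_mul, mul_smul, hI x x.2, Tens.right_smul_tmul, inclTens_tmul,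
      op_smul_eq_mul, one_mul]
  | add x y hx hy => rw [map_add, op_add, add_smul, hx, hy, map_add]

/-- The sub-bimodule `{t | c t = t ⊗ 1}` is right invertible if it and `c` behave well under
`- ⊗_B S`. -/
theorem mulMap_bijective {c : Tens B S S} (hc : mulHom B S c = 1) {I : SubBimodule B S}
    (hI : ∀ t ∈ I, op t • c = Tens.tmul B t 1) (hinj : Function.Injective (inclTens I))
    (hmem : ∃ w, inclTens I w = c) : Function.Bijective (SubBimodule.mulMap I) := by
  refine ⟨fun z w h => hinj ?_, fun s => ?_⟩
  -- The image of `z` in `S ⊗_B S` is `c m(z)`, so it depends only on `m(z)`.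
  · rw [← op_mulMap_smul hI, ← op_mulMap_smul hI, h]
  · obtain ⟨w, rfl⟩ := hmem
    -- A preimage of `s` is `w s`, because `m(w)` is the product of `c`, which is `1`.
    exact ⟨op s • w, by rw [SubBimodule.mulMap_op_smul, ← mulHom_inclTens, hc, one_mul]⟩

/-! #### The element of `S ⊗_B S` given by a right invertible sub-bimodule -/

/-- The image of `m⁻¹(1)` in `S ⊗_B S`. -/
noncomputable def unitCoeff (I : SubBimodule.rightInvertible B S) : Tens B S S :=
  inclTens I.1 ((SubBimodule.mulEquiv I).symm 1)

theorem mulHom_unitCoeff (I : SubBimodule.rightInvertible B S) : mulHom B S (unitCoeff I) = 1 := by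
  rw [unitCoeff, mulHom_inclTens, SubBimodule.mulMap_mulEquiv_symm]

theorem inclTens_op_smul (I : SubBimodule B S) (s : S) (z : Tens B I S) :
    inclTens I (op s • z) = op s • inclTens I z := by
  induction z using Tens.induction_on with
  | zero => simp
  | tmul x y => rfl
  | add x y hx hy => rw [smul_add, map_add, map_add, hx, hy, smul_add]

/-- `c m(z) = z` for `c` the image of `m⁻¹(1)`. -/
theorem op_smul_unitCoeff_mulMap (I : SubBimodule.rightInvertible B S)
    (z : Tens B (I : SubBimodule B S) S) :
    op (SubBimodule.mulMap I.1 z) • unitCoeff I = inclTens I.1 z := by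
  rw [unitCoeff, ← inclTens_op_smul]
  congr 1
  -- Already in `I ⊗_B S`, the elements `m⁻¹(1) m(z)` and `z` have the same image under the
  -- injective map `m`.
  apply I.2.1
  rw [SubBimodule.mulMap_op_smul, SubBimodule.mulMap_mulEquiv_symm, one_mul]

theorem op_smul_unitCoeff (I : SubBimodule.rightInvertible B S) (t : S) (ht : t ∈ I.1) :
    op t • unitCoeff I = Tens.tmul B t 1 := by
  have h := op_smul_unitCoeff_mulMap I (Tens.tmul B ⟨t, ht⟩ 1)
  rwa [SubBimodule.mulMap_tmul, mul_one] at h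

/-- Left multiplication by `b` preserves `I` and satisfies `m(b z) = b m(z)`. Taking `z = m⁻¹(1)` in
`c m(b z) = b z` gives `c b = b c`. -/
theorem unitCoeff_central (I : SubBimodule.rightInvertible B S) (b : B) :
    (b • (1 : S)) • unitCoeff I = op (b • (1 : S)) • unitCoeff I := by
  let l : I.1 →ₗ[Bᵐᵒᵖ] I.1 :=
    { toFun := fun x => ⟨b • (x : S), I.1.smul_mem b x x.2⟩
      map_add' := fun x y => Subtype.ext (smul_add _ _ _)
      map_smul' := fun a x => Subtype.ext (smul_mul_assoc b (x : S) _).symm }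
  have h1 : ∀ z : Tens B I.1 S, inclTens I.1 (Tens.map l LinearMap.id z) =
      (b • (1 : S)) • inclTens I.1 z ∧
      SubBimodule.mulMap I.1 (Tens.map l LinearMap.id z) = b • SubBimodule.mulMap I.1 z := by
    intro z
    induction z using Tens.induction_on with
    | zero => simp
    | tmul x y =>
      refine ⟨?_, smul_mul_assoc b (x : S) y⟩
      change Tens.tmul B (b • (x : S)) y = Tens.tmul B ((b • (1 : S)) * (x : S)) y
      rw [smul_one_mul]
    | add x y hx hy => simp only [map_add, hx, hy, smul_add, and_self]
  have h2 := op_smul_unitCoeff_mulMap I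
    (Tens.map l LinearMap.id ((SubBimodule.mulEquiv I).symm 1))
  rw [(h1 _).1, (h1 _).2, SubBimodule.mulMap_mulEquiv_symm] at h2
  exact h2.symm

/-- The maps `s ↦ c s` and `s ↦ s ⊗ 1` agree on `I`, and `c` comes from `I ⊗_B S`. -/
theorem unitCoeff_isCocycle (I : SubBimodule.rightInvertible B S) : IsCocycle (unitCoeff I) := by
  unfold IsCocycle
  have h : (mulRight (unitCoeff I)).comp (incl I.1) = (unitRight B S).comp (incl I.1) :=
    LinearMap.ext fun t => op_smul_unitCoeff I t t.2
  nth_rw 2 [unitCoeff]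
  nth_rw 2 [unitCoeff]
  unfold inclTens
  rw [Tens.map_map, Tens.map_map, h]

/-- An element `c` with `c t = t ⊗ 1` for all `t` in a right invertible `I` is determined by `I`. -/
theorem eq_unitCoeff {c : Tens B S S} (I : SubBimodule.rightInvertible B S)
    (hI : ∀ t ∈ I.1, op t • c = Tens.tmul B t 1) : unitCoeff I = c := by
  rw [unitCoeff, ← op_mulMap_smul hI, SubBimodule.mulMap_mulEquiv_symm, op_one, one_smul]

end

/-! ### Recovering `I` from its element `c`; flat extensions -/

section

universe v

variable {B : Type*} {S : Type v} [Ring B] [Ring S] [Module B S] [IsScalarTower B S S]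
  [Module Bᵐᵒᵖ S] [IsRingExtension B S]

/-- If `n ⊗ 1 = 0` in `N ⊗_B S` only for `n = 0`, then a right invertible `I` consists of all `t`
with `c t = t ⊗ 1`, where `c` is the image of `m⁻¹(1)`. -/
theorem mem_of_op_smul_unitCoeff
    (hS : ∀ (N : Type v) [AddCommGroup N] [Module Bᵐᵒᵖ N] (n : N),
      Tens.tmul B n (1 : S) = 0 → n = 0)
    (I : SubBimodule.rightInvertible B S) {t : S}
    (ht : op t • unitCoeff I = Tens.tmul B t 1) : t ∈ I.1 := by
  let p : Submodule Bᵐᵒᵖ S := LinearMap.range (incl I.1)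
  have h0 : ∀ z : Tens B I.1 S, Tens.map p.mkQ (LinearMap.id : S →ₗ[B] S) (inclTens I.1 z) = 0 := by
    intro z
    induction z using Tens.induction_on with
    | zero => simp
    | tmul x y =>
      have hx : p.mkQ (x : S) = 0 := (Submodule.Quotient.mk_eq_zero p).2 ⟨x, rfl⟩
      rw [inclTens_tmul, Tens.map_tmul, hx, Tens.zero_tmul]
    | add x y hx hy => rw [map_add, map_add, hx, hy, add_zero]
  -- Since `c t` comes from `I ⊗_B S`, it dies in `(S ⧸ I) ⊗_B S`; as `c t = t ⊗ 1`, so does `t ⊗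
  -- 1`.
  have h1 := hS (S ⧸ p) (p.mkQ t) (by
    have h := h0 (op t • (SubBimodule.mulEquiv I).symm 1)
    rw [inclTens_op_smul] at h
    change Tens.map _ _ (op t • unitCoeff I) = 0 at h
    rw [ht] at h
    exact h)
  obtain ⟨x, hx⟩ := (Submodule.Quotient.mk_eq_zero p).1 h1
  rw [← hx]
  exact x.2

/-- The case of a flat ring extension. -/
theorem mulMap_bijective_of_flat
    (hS : ∀ (N N' : Type v) [AddCommGroup N] [Module Bᵐᵒᵖ N] [AddCommGroup N'] [Module Bᵐᵒᵖ N']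
      (f : N →ₗ[Bᵐᵒᵖ] N'), Function.Injective f →
        Function.Injective (Tens.map f (LinearMap.id : S →ₗ[B] S)))
    {c : Tens B S S} (hc : mulHom B S c = 1) (hcoc : IsCocycle c) {I : SubBimodule B S}
    (hI : ∀ t, t ∈ I ↔ op t • c = Tens.tmul B t 1) :
    Function.Bijective (SubBimodule.mulMap I) := by
  refine mulMap_bijective hc (fun t => (hI t).1) (hS _ _ _ Subtype.val_injective) ?_
  let δ : S →ₗ[Bᵐᵒᵖ] Tens B S S := mulRight c - unitRight B S
  let p : Submodule Bᵐᵒᵖ S := LinearMap.ker δ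
  let l : (S ⧸ p) →ₗ[Bᵐᵒᵖ] Tens B S S := p.liftQ δ le_rfl
  have hl : Function.Injective l := LinearMap.ker_eq_bot.1 (Submodule.ker_liftQ_eq_bot' p δ rfl)
  -- Flatness keeps the embedding of `S ⧸ p` into `S ⊗_B S` injective after tensoring with `S`. The
  -- composite sends `c` to the difference of the two sides of the cocycle condition, so `c`
  -- vanishes in `(S ⧸ p) ⊗_B S` and comes from `p ⊗_B S`.
  have h0 : Tens.map p.mkQ (LinearMap.id : S →ₗ[B] S) c = 0 := by
    apply hS _ _ l hl
    rw [Tens.map_map, map_zero, Submodule.liftQ_mkQ]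
    change Tens.map (mulRight c - unitRight B S) LinearMap.id c = 0
    rw [Tens.map_sub_left, sub_eq_zero]
    exact hcoc
  obtain ⟨w, hw⟩ := Tens.exists_map_subtype_eq p c h0
  let j : p →ₗ[Bᵐᵒᵖ] I :=
    { toFun := fun x => ⟨x, (hI x).2 (sub_eq_zero.1 x.2)⟩
      map_add' := fun _ _ => rfl
      map_smul' := fun b x => Subtype.ext (op_smul_eq b.unop (x : S)) }
  refine ⟨Tens.map j LinearMap.id w, ?_⟩
  rw [inclTens, Tens.map_map]
  exact hw

end

/-! ### Split extensions -/

section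

variable {B S : Type*} [Ring B] [Ring S] [Module B S] [IsScalarTower B S S] [Module Bᵐᵒᵖ S]
  [IsRingExtension B S]

/-- The map `N ⊗_B S → N`, `n ⊗ s ↦ n E(s)`, for a `(B, B)`-bimodule map `E : S → B`. -/
def retract (E : BimodHom B B S B) (N : Type*) [AddCommGroup N] [Module Bᵐᵒᵖ N] :
    Tens B N S →ₗ[Bᵐᵒᵖ] N :=
  let r : Tens B N S →+ N := Tens.lift
    (AddMonoidHom.mk' (fun n => AddMonoidHom.mk' (fun s => op (E s) • n)
        (fun s s' => by rw [BimodHom.map_add, op_add, add_smul]))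
      (fun n n' => by ext s; exact smul_add _ n n'))
    (fun n b s => by
      change op (E s) • op b • n = op (E (b • s)) • n
      rw [smul_smul, ← op_mul]
      congr 2
      exact (E.toLeft.map_smul b s).symm)
  { toFun := r
    map_add' := r.map_add
    map_smul' := fun b z => by
      rw [RingHom.id_apply, ← op_unop b]
      induction z using Tens.induction_on with
      | zero => simp
      | tmul n s =>
        change op (E (op b.unop • s)) • n = op b.unop • op (E s) • n
        rw [smul_smul, ← op_mul]
        congr 2
        exact E.map_op_smul' b.unop s
      | add x y hx hy => rw [smul_add, map_add, hx, hy, map_add, smul_add] }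

theorem retract_tmul (E : BimodHom B B S B) {N : Type*} [AddCommGroup N] [Module Bᵐᵒᵖ N]
    (n : N) (s : S) : retract E N (Tens.tmul B n s) = op (E s) • n := rfl

theorem retract_tmul_one {E : BimodHom B B S B} (hE : E 1 = 1) {N : Type*} [AddCommGroup N]
    [Module Bᵐᵒᵖ N] (n : N) : retract E N (Tens.tmul B n 1) = n := by
  rw [retract_tmul, hE, op_one, one_smul]

/-- Naturality in `N`; it allows the retractions of `S ⊗_B S` and `(S ⊗_B S) ⊗_B S` to be compared.
-/
theorem retract_map (E : BimodHom B B S B) {N N' : Type*} [AddCommGroup N] [Module Bᵐᵒᵖ N]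
    [AddCommGroup N'] [Module Bᵐᵒᵖ N'] (f : N →ₗ[Bᵐᵒᵖ] N') (z : Tens B N S) :
    retract E N' (Tens.map f LinearMap.id z) = f (retract E N z) := by
  induction z using Tens.induction_on with
  | zero => simp
  | tmul n s => exact (f.map_smul _ _).symm
  | add x y hx hy => simp only [map_add, hx, hy]

/-- The case of a split ring extension. -/
theorem mulMap_bijective_of_split {E : BimodHom B B S B} (hE : E 1 = 1)
    {c : Tens B S S} (hc : mulHom B S c = 1) (hcoc : IsCocycle c) {I : SubBimodule B S}
    (hI : ∀ t, t ∈ I ↔ op t • c = Tens.tmul B t 1) :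
    Function.Bijective (SubBimodule.mulMap I) := by
  have hmem : ∀ s, retract E S (mulRight c s) ∈ I := fun s => by
    -- Multiply the cocycle condition by `s` on the right and apply `E` to the last factor. With `x
    -- = ∑ t_k E(s_k s)` the result reads `c x = x ⊗ 1`.
    have h := congrArg (fun z => retract E (Tens B S S) (op s • z)) hcoc
    simp only [← Tens.map_right_smul, retract_map] at h
    exact (hI _).2 h
  let P : S →ₗ[Bᵐᵒᵖ] I :=
    { toFun := fun s => ⟨retract E S (mulRight c s), hmem s⟩
      map_add' := fun s s' => Subtype.ext (((retract E S).comp (mulRight c)).map_add s s')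
      map_smul' := fun b s => Subtype.ext
        ((((retract E S).comp (mulRight c)).map_smul b s).trans (op_smul_eq b.unop _)) }
  -- `P` is a right `B`-linear projection of `S` onto `I`, so the inclusion of `I` stays injective
  -- after tensoring with `S`.
  have hP : P.comp (incl I) = LinearMap.id := LinearMap.ext fun x => Subtype.ext <| by
    change retract E S (op (x : S) • c) = x
    rw [(hI _).1 x.2, retract_tmul_one hE]
  have hP' : (incl I).comp P = (retract E S).comp (mulRight c) := rfl
  have hr : (retract E S).comp (unitRight B S) = LinearMap.id :=
    LinearMap.ext fun x => retract_tmul_one hE x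
  refine mulMap_bijective hc (fun t => (hI t).1) ?_ ⟨Tens.map P LinearMap.id c, ?_⟩
  · refine Function.LeftInverse.injective (g := Tens.map P LinearMap.id) fun z => ?_
    rw [inclTens, Tens.map_map, hP]
    exact Tens.map_id_id z
  -- Here `E` is applied to the middle factor of the cocycle condition: its right side returns `c`,
  -- and its left side is the image of `(P ⊗ S)(c)`, which lies in the image of `I ⊗_B S`.
  · rw [inclTens, Tens.map_map, hP', ← Tens.map_map _ LinearMap.id, hcoc, Tens.map_map, hr]
    exact Tens.map_id_id c

end

end RingExtension

/-! ### The ring extension `B → End(M_A)` -/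

section

variable {A B M : Type*} [Ring A] [Ring B] [AddCommGroup M] [Module B M] [Module Aᵐᵒᵖ M]
  [SMulCommClass B Aᵐᵒᵖ M]

/-- `(s b)(m) = s(b m)`. -/
instance (priority := low) instModuleEndRight : Module Bᵐᵒᵖ (Module.End Aᵐᵒᵖ M) where
  smul b s := s * Module.toModuleEnd Aᵐᵒᵖ M b.unop
  one_smul s := by
    change s * Module.toModuleEnd Aᵐᵒᵖ M (1 : B) = s
    rw [map_one, mul_one]
  mul_smul a b s := by
    change s * Module.toModuleEnd Aᵐᵒᵖ M (b.unop * a.unop) = s * _ * _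
    rw [map_mul, mul_assoc]
  smul_zero a := zero_mul _
  smul_add a s t := add_mul _ _ _
  add_smul a b s := by
    change s * Module.toModuleEnd Aᵐᵒᵖ M (a.unop + b.unop) = s * _ + s * _
    rw [map_add, mul_add]
  zero_smul s := by
    change s * Module.toModuleEnd Aᵐᵒᵖ M (0 : B) = 0
    rw [map_zero, mul_zero]

instance instIsRingExtensionEnd : IsRingExtension B (Module.End Aᵐᵒᵖ M) where
  op_smul_eq _ _ := rfl

/-- The endomorphism `x ↦ m h(x)`. -/
def rankOne (m : M) (h : RightDual A M) : Module.End Aᵐᵒᵖ M where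
  toFun x := op (h x) • m
  map_add' x y := by rw [RightDual.map_add, op_add, add_smul]
  map_smul' a x := by
    rw [RingHom.id_apply, ← op_unop a, RightDual.map_op_smul, op_mul, mul_smul]

@[simp] theorem rankOne_apply (m : M) (h : RightDual A M) (x : M) :
    rankOne m h x = op (h x) • m := rfl

theorem DualBasis.sum_rankOne (D : DualBasis A M) (s : Module.End Aᵐᵒᵖ M) :
    ∑ j, rankOne (s (D.e j)) (D.eStar j) = s := LinearMap.ext fun x => by
  conv_rhs => rw [← D.sum_eq x]
  rw [LinearMap.sum_apply, map_sum]
  exact Finset.sum_congr rfl fun j _ => (s.map_smul _ _).symm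

/-- The map `h ↦ m h(-)`. -/
def rankOneLeft (B : Type*) [Ring B] [Module B M] [SMulCommClass B Aᵐᵒᵖ M] (m : M) :
    RightDual A M →ₗ[Bᵐᵒᵖ] Module.End Aᵐᵒᵖ M where
  toFun h := rankOne m h
  map_add' h h' := LinearMap.ext fun x => by
    rw [rankOne_apply, RightDual.add_apply, op_add, add_smul]; rfl
  map_smul' _ _ := rfl

/-- The map `m ↦ m h(-)`. -/
def rankOneRight (B : Type*) [Ring B] [Module B M] [SMulCommClass B Aᵐᵒᵖ M] (h : RightDual A M) :
    M →ₗ[B] Module.End Aᵐᵒᵖ M where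
  toFun m := rankOne m h
  map_add' m m' := LinearMap.ext fun _ => smul_add _ m m'
  map_smul' b m := LinearMap.ext fun x => (smul_comm b (op (h x)) m).symm

/-- The map `M^* ⊗_B M → S ⊗_B S`, `f ⊗ u ↦ m f(-) ⊗ u h(-)`. -/
def coeffMap (m : M) (h : RightDual A M) :
    Comatrix A B M →+ Tens B (Module.End Aᵐᵒᵖ M) (Module.End Aᵐᵒᵖ M) :=
  Tens.map (rankOneLeft B m) (rankOneRight B h)

theorem coeffMap_tmul (m : M) (h f : RightDual A M) (u : M) :
    coeffMap m h (Tens.tmul B f u) = Tens.tmul B (rankOne m f) (rankOne u h) := rfl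

theorem coeffMap_add_right (m : M) (h h' : RightDual A M) (c : Comatrix A B M) :
    coeffMap m (h + h') c = coeffMap m h c + coeffMap m h' c := by
  induction c using Tens.induction_on with
  | zero => simp
  | tmul f u =>
    rw [coeffMap_tmul, coeffMap_tmul, coeffMap_tmul, ← Tens.tmul_add]
    exact congrArg _ ((rankOneLeft B u).map_add h h')
  | add x y hx hy => rw [map_add, map_add, map_add, hx, hy]; abel

theorem coeffMap_op_smul_right (m : M) (b : B) (h : RightDual A M) (c : Comatrix A B M) :
    coeffMap m (op b • h) c = op b • coeffMap m h c := by
  induction c using Tens.induction_on with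
  | zero => simp
  | tmul f u => rfl
  | add x y hx hy => rw [map_add, map_add, smul_add, hx, hy]

theorem coeffMap_op_smul (m : M) (a : A) (h : RightDual A M) (c : Comatrix A B M) :
    coeffMap m h (op a • c) = coeffMap m (a • h) c := by
  induction c using Tens.induction_on with
  | zero => simp
  | tmul f u =>
    rw [Tens.right_smul_tmul, coeffMap_tmul, coeffMap_tmul]
    congr 1
    refine LinearMap.ext fun x => ?_
    rw [rankOne_apply, rankOne_apply, smul_smul, RightDual.smul_apply, op_mul]
  | add x y hx hy => rw [smul_add, map_add, map_add, hx, hy]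

/-- The map `s ↦ f s`. -/
def compLeft (B : Type*) [Ring B] [Module B M] [SMulCommClass B Aᵐᵒᵖ M] (f : RightDual A M) :
    Module.End Aᵐᵒᵖ M →ₗ[Bᵐᵒᵖ] RightDual A M where
  toFun s := RightDual.comp f s
  map_add' s t := RightDual.ext fun m => RightDual.map_add f (s m) (t m)
  map_smul' _ _ := rfl

/-- The map `s ↦ s(u)`. -/
def evalAt (B : Type*) [Ring B] [Module B M] [SMulCommClass B Aᵐᵒᵖ M] (u : M) :
    Module.End Aᵐᵒᵖ M →ₗ[B] M where
  toFun s := s u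
  map_add' _ _ := rfl
  map_smul' _ _ := rfl

/-- The map `S ⊗_B S → M^* ⊗_B M`, `t ⊗ s ↦ f t ⊗ s u`. -/
def act (f : RightDual A M) (u : M) :
    Tens B (Module.End Aᵐᵒᵖ M) (Module.End Aᵐᵒᵖ M) →+ Comatrix A B M :=
  Tens.map (compLeft B f) (evalAt B u)

theorem act_tmul (f : RightDual A M) (u : M) (t s : Module.End Aᵐᵒᵖ M) :
    act f u (Tens.tmul B t s) = Tens.tmul B (RightDual.comp f t) (s u) := rfl

/-! ### Bilinearity of the action of `S ⊗_B S` on `M^* ⊗_B M` -/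

section

variable (z : Tens B (Module.End Aᵐᵒᵖ M) (Module.End Aᵐᵒᵖ M))

theorem act_add_left (f f' : RightDual A M) (u : M) :
    act (f + f') u z = act f u z + act f' u z := by
  induction z using Tens.induction_on with
  | zero => simp
  | tmul t s => exact Tens.add_tmul (RightDual.comp f t) (RightDual.comp f' t) (s u)
  | add x y hx hy => rw [map_add, map_add, map_add, hx, hy]; abel

theorem act_add_right (f : RightDual A M) (u u' : M) :
    act f (u + u') z = act f u z + act f u' z := by
  induction z using Tens.induction_on with
  | zero => simp
  | tmul t s =>
    rw [act_tmul, map_add]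
    exact Tens.tmul_add _ _ _
  | add x y hx hy => rw [map_add, map_add, map_add, hx, hy]; abel

theorem act_smul_left (a : A) (f : RightDual A M) (u : M) :
    act (a • f) u z = a • act f u z := by
  induction z using Tens.induction_on with
  | zero => simp
  | tmul t s => rfl
  | add x y hx hy => rw [map_add, map_add, smul_add, hx, hy]

theorem act_op_smul_right (a : A) (f : RightDual A M) (u : M) :
    act f (op a • u) z = op a • act f u z := by
  induction z using Tens.induction_on with
  | zero => simp
  | tmul t s => rw [act_tmul, map_smul]; rfl
  | add x y hx hy => rw [map_add, map_add, smul_add, hx, hy]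

theorem act_comp (f : RightDual A M) (s : Module.End Aᵐᵒᵖ M) (u : M) :
    act (RightDual.comp f s) u z = act f u (s • z) := by
  induction z using Tens.induction_on with
  | zero => simp
  | tmul t s => rfl
  | add x y hx hy => rw [map_add, smul_add, map_add, hx, hy]

theorem act_apply (f : RightDual A M) (s : Module.End Aᵐᵒᵖ M) (u : M) :
    act f (s u) z = act f u (op s • z) := by
  induction z using Tens.induction_on with
  | zero => simp
  | tmul t s => rfl
  | add x y hx hy => rw [map_add, smul_add, map_add, hx, hy]

theorem counit_act (f : RightDual A M) (u : M) :
    comatrixCounit A B M (act f u z) = f (RingExtension.mulHom B (Module.End Aᵐᵒᵖ M) z u) := by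
  induction z using Tens.induction_on with
  | zero => rw [map_zero (act f u), map_zero (RingExtension.mulHom _ _), BimodHom.map_zero, LinearMap.zero_apply, RightDual.map_zero]
  | tmul t s => rfl
  | add x y hx hy =>
    rw [map_add (act f u), map_add (RingExtension.mulHom _ _), BimodHom.map_add, LinearMap.add_apply, RightDual.map_add, hx, hy]

end

/-- Left inverse of the family of maps `act`. -/
theorem sum_coeffMap_act (D : DualBasis A M)
    (z : Tens B (Module.End Aᵐᵒᵖ M) (Module.End Aᵐᵒᵖ M)) :
    ∑ i, ∑ j, coeffMap (D.e i) (D.eStar j) (act (D.eStar i) (D.e j) z) = z := by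
  induction z using Tens.induction_on with
  | zero => simp
  | tmul t s =>
    -- Both factors are expanded in the dual basis: `t = ∑ e_i (e_i^* t)` and `s = ∑ s(e_j) e_j^*`.
    have ht : ∑ i, rankOne (D.e i) (RightDual.comp (D.eStar i) t) = t := LinearMap.ext fun x => by
      rw [LinearMap.sum_apply]; exact D.sum_eq (t x)
    conv_rhs => rw [← ht, ← D.sum_rankOne s, Tens.sum_tmul]
    refine Finset.sum_congr rfl fun i _ => ?_
    rw [Tens.tmul_sum]
    rfl
  | add x y hx hy =>
    conv_rhs => rw [← hx, ← hy]
    simp only [map_add, Finset.sum_add_distrib]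

/-- The dual basis reconstructs `z` from the finitely many values `act (e_i^*) (e_j) z`. -/
theorem eq_of_act_eq (D : DualBasis A M) {z w : Tens B (Module.End Aᵐᵒᵖ M) (Module.End Aᵐᵒᵖ M)}
    (h : ∀ f u, act f u z = act f u w) : z = w := by
  rw [← sum_coeffMap_act D z, ← sum_coeffMap_act D w]
  simp only [h]

theorem act_coeffMap (f h : RightDual A M) (u m : M) (c : Comatrix A B M) :
    act f u (coeffMap m h c) = f m • op (h u) • c := by
  induction c using Tens.induction_on with
  | zero => simp
  | tmul k x =>
    rw [coeffMap_tmul, act_tmul, Tens.right_smul_tmul, Tens.left_smul_tmul, rankOne_apply]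
    congr 1
    refine RightDual.ext fun y => ?_
    rw [RightDual.comp_apply, rankOne_apply, RightDual.map_op_smul, RightDual.smul_apply]
  | add x y hx hy => rw [map_add, map_add, hx, hy, smul_add, smul_add]

/-- The element of `S ⊗_B S` corresponding to an endomorphism of the bimodule `M^* ⊗_B M`. -/
def coeff (D : DualBasis A M) (g : BimodHom A A (Comatrix A B M) (Comatrix A B M)) :
    Tens B (Module.End Aᵐᵒᵖ M) (Module.End Aᵐᵒᵖ M) :=
  ∑ i, ∑ j, coeffMap (D.e i) (D.eStar j) (g (Tens.tmul B (D.eStar i) (D.e j)))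

/-- Expand `f = ∑ f(e_i) e_i^*` and `u = ∑ e_j e_j^*(u)`: since `g` is a map of `A`-bimodules, its
values on the tensors `e_i^* ⊗ e_j`, stored in `coeff`, determine it. -/
theorem act_coeff (D : DualBasis A M) (g : BimodHom A A (Comatrix A B M) (Comatrix A B M))
    (f : RightDual A M) (u : M) : act f u (coeff D g) = g (Tens.tmul B f u) := by
  conv_rhs => rw [← D.sum_smul_eStar f, ← D.sum_eq u, Tens.sum_tmul, ← g.toLeft_apply, map_sum]
  rw [coeff, map_sum]
  refine Finset.sum_congr rfl fun i _ => ?_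
  rw [Tens.tmul_sum, map_sum, map_sum]
  refine Finset.sum_congr rfl fun j _ => ?_
  rw [act_coeffMap, ← Tens.left_smul_tmul, ← Tens.right_smul_tmul, map_smul]
  exact congrArg _ (g.map_op_smul' _ _).symm

theorem eq_of_dual_eq (D : DualBasis A M) {x y : M} (h : ∀ f : RightDual A M, f x = f y) :
    x = y := by
  rw [← D.sum_eq x, ← D.sum_eq y]
  simp only [h]

/-- The counit sends the value of `g` at `f ⊗ u` to `f(∑ t_k s_k u)`, and elements of `M^*` separate
the points of `M`. -/
theorem mulHom_coeff (D : DualBasis A M) (g : CoringEnd (comatrixCoring B D)) :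
    RingExtension.mulHom B _ (coeff D g.toBimodHom) = 1 := by
  refine LinearMap.ext fun u => eq_of_dual_eq D fun f => ?_
  rw [← counit_act, act_coeff]
  exact g.counit_comp _

/-! ### The cocycle condition -/

/-- The centrality of `∑ e_i ⊗ e_i^*` under `S`, carried into the tensor square of the coring. It
moves an endomorphism across the middle tensor sign. -/
theorem sum_act_tmul (D : DualBasis A M) (f : RightDual A M)
    (w : Tens B (Module.End Aᵐᵒᵖ M) (Module.End Aᵐᵒᵖ M)) (s : Module.End Aᵐᵒᵖ M) (x : M) :
    ∑ i, Tens.tmul A (act f (s (D.e i)) w) (Tens.tmul B (D.eStar i) x) =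
      ∑ i, Tens.tmul A (act f (D.e i) w) (Tens.tmul B (RightDual.comp (D.eStar i) s) x) := by
  let l : M →ₗ[Aᵐᵒᵖ] Comatrix A B M :=
    { toFun := fun m => act f m w
      map_add' := act_add_right w f
      map_smul' := fun a m => act_op_smul_right w a.unop f m }
  have h := congrArg (Tens.map l (Tens.tmulRight (T := B) x)) (D.sum_comm s)
  rw [map_sum, map_sum] at h
  exact h

/-- The map `(S ⊗_B S) ⊗_B S → (M^* ⊗_B M) ⊗_A (M^* ⊗_B M)`,
`(t ⊗ s) ⊗ r ↦ ∑ (f t ⊗ s e_i) ⊗ (e_i^* ⊗ r u)`. -/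
def tripleAct (D : DualBasis A M) (f : RightDual A M) (u : M) :
    Tens B (Tens B (Module.End Aᵐᵒᵖ M) (Module.End Aᵐᵒᵖ M)) (Module.End Aᵐᵒᵖ M) →+
      Tens A (Comatrix A B M) (Comatrix A B M) :=
  Tens.lift (AddMonoidHom.mk' (fun w => AddMonoidHom.mk'
      (fun r => ∑ i, Tens.tmul A (act f (D.e i) w) (Tens.tmul B (D.eStar i) (r u)))
      (fun r r' => by simp only [LinearMap.add_apply, Tens.tmul_add, Finset.sum_add_distrib]))
      (fun w w' => AddMonoidHom.ext fun r => by
        simp only [AddMonoidHom.mk'_apply, AddMonoidHom.add_apply, map_add, Tens.add_tmul,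
          Finset.sum_add_distrib]))
    (fun w b r => by
      change ∑ i, Tens.tmul A (act f (D.e i) (op b • w)) (Tens.tmul B (D.eStar i) (r u)) =
        ∑ i, Tens.tmul A (act f (D.e i) w) (Tens.tmul B (D.eStar i) (b • r u))
      have h := sum_act_tmul D f w (b • (1 : Module.End Aᵐᵒᵖ M)) (r u)
      simp only [act_apply] at h
      rw [RingExtension.op_smul_tens, h]
      exact Finset.sum_congr rfl fun i _ => congrArg _ (Tens.smul_tmul (D.eStar i) b (r u)))

theorem tripleAct_tmul (D : DualBasis A M) (f : RightDual A M) (u : M)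
    (w : Tens B (Module.End Aᵐᵒᵖ M) (Module.End Aᵐᵒᵖ M)) (r : Module.End Aᵐᵒᵖ M) :
    tripleAct D f u (Tens.tmul B w r) =
      ∑ i, Tens.tmul A (act f (D.e i) w) (Tens.tmul B (D.eStar i) (r u)) := rfl

/-- Turns the `t_k ⊗ 1 ⊗ s_k` side of the cocycle condition into the comultiplication applied after
the endomorphism. -/
theorem tripleAct_unitRight (D : DualBasis A M) (f : RightDual A M) (u : M)
    (z : Tens B (Module.End Aᵐᵒᵖ M) (Module.End Aᵐᵒᵖ M)) :
    tripleAct D f u (Tens.map (RingExtension.unitRight B _) LinearMap.id z) =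
      comatrixComul D (act f u z) := by
  induction z using Tens.induction_on with
  | zero => rw [map_zero, map_zero, map_zero, BimodHom.map_zero]
  | tmul t s => rfl
  | add x y hx hy => rw [map_add, map_add, map_add, BimodHom.map_add, hx, hy]

/-- With `z = c`, turns the other side of the cocycle condition into `g ⊗ g` applied after the
comultiplication. The inner factor `t` is moved from `e_i` to `e_i^*` by centrality. -/
theorem tripleAct_mulRight (D : DualBasis A M) (f : RightDual A M) (u : M)
    (c z : Tens B (Module.End Aᵐᵒᵖ M) (Module.End Aᵐᵒᵖ M)) :
    tripleAct D f u (Tens.map (RingExtension.mulRight c) LinearMap.id z) =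
      ∑ i, Tens.tmul A (act f (D.e i) c) (act (D.eStar i) u z) := by
  induction z using Tens.induction_on with
  | zero => simp [Tens.tmul_zero]
  | tmul t s =>
    rw [Tens.map_tmul, tripleAct_tmul, RingExtension.mulRight_apply]
    simp only [← act_apply]
    exact sum_act_tmul D f c t (s u)
  | add x y hx hy => simp only [map_add, hx, hy, Tens.tmul_add, Finset.sum_add_distrib]

/-- The map `(M^* ⊗_B M) ⊗_A (M^* ⊗_B M) → (S ⊗_B S) ⊗_B S`,
`(f ⊗ u) ⊗ (f' ⊗ u') ↦ (m f(-) ⊗ u f'(-)) ⊗ u' h(-)`. -/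
def tripleCoeff (m : M) (h : RightDual A M) : Tens A (Comatrix A B M) (Comatrix A B M) →+
    Tens B (Tens B (Module.End Aᵐᵒᵖ M) (Module.End Aᵐᵒᵖ M)) (Module.End Aᵐᵒᵖ M) :=
  let l : Comatrix A B M →
      (RightDual A M →ₗ[Bᵐᵒᵖ] Tens B (Module.End Aᵐᵒᵖ M) (Module.End Aᵐᵒᵖ M)) := fun x =>
    { toFun := fun f => coeffMap m f x
      map_add' := fun f f' => coeffMap_add_right m f f' x
      map_smul' := fun b f => coeffMap_op_smul_right m b.unop f x }
  Tens.lift (AddMonoidHom.mk' (fun x => Tens.map (l x) (rankOneRight B h))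
      (fun x x' => Tens.addHom_ext fun f u => by
        change Tens.tmul B (coeffMap m f (x + x')) _ =
          Tens.tmul B (coeffMap m f x) _ + Tens.tmul B (coeffMap m f x') _
        rw [map_add, Tens.add_tmul]))
    (fun x a y => by
      change Tens.map (l (op a • x)) _ y = Tens.map (l x) _ (a • y)
      induction y using Tens.induction_on with
      | zero => simp
      | tmul f u =>
        exact congrArg (Tens.tmul B · (rankOne u h)) (coeffMap_op_smul m a f x)
      | add y y' hy hy' => rw [smul_add, map_add, map_add, hy, hy'])

/-- Left inverse of the family of maps `tripleAct`. -/
theorem sum_tripleCoeff_tripleAct (D : DualBasis A M)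
    (z : Tens B (Tens B (Module.End Aᵐᵒᵖ M) (Module.End Aᵐᵒᵖ M)) (Module.End Aᵐᵒᵖ M)) :
    ∑ i, ∑ j, tripleCoeff (D.e i) (D.eStar j) (tripleAct D (D.eStar i) (D.e j) z) = z := by
  induction z using Tens.induction_on with
  | zero => simp
  | tmul w r =>
    conv_rhs => rw [← D.sum_rankOne r, ← sum_coeffMap_act D w, Tens.sum_tmul]
    refine Finset.sum_congr rfl fun i _ => ?_
    rw [Tens.tmul_sum]
    refine Finset.sum_congr rfl fun j _ => ?_
    rw [tripleAct_tmul, map_sum, Tens.sum_tmul]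
    rfl
  | add x y hx hy =>
    conv_rhs => rw [← hx, ← hy]
    simp only [map_add, Finset.sum_add_distrib]

/-- The maps `tripleAct D f u` send the two sides to the two sides of the identity for `g` and the
comultiplication, and they are jointly injective. -/
theorem coeff_isCocycle (D : DualBasis A M) (g : CoringEnd (comatrixCoring B D)) :
    RingExtension.IsCocycle (coeff D g.toBimodHom) := by
  have h : ∀ f u, tripleAct D f u (Tens.map (RingExtension.mulRight (coeff D g.toBimodHom))
      LinearMap.id (coeff D g.toBimodHom)) = tripleAct D f u
        (Tens.map (RingExtension.unitRight B _) LinearMap.id (coeff D g.toBimodHom)) := by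
    intro f u
    rw [tripleAct_unitRight, tripleAct_mulRight]
    simp only [act_coeff]
    refine Eq.trans ?_ (g.comul_comp (Tens.tmul B f u)).symm
    change _ = Tens.map _ _ (comatrixComul D (Tens.tmul B f u))
    rw [comatrixComul_tmul, map_sum]
    rfl
  unfold RingExtension.IsCocycle
  rw [← sum_tripleCoeff_tripleAct D (Tens.map (RingExtension.unitRight B _) _ _)]
  simp only [← h]
  exact (sum_tripleCoeff_tripleAct D _).symm

/-! ### The coring endomorphism given by an element of `S ⊗_B S` -/

/-- The map `f ⊗ u ↦ ∑ f t_k ⊗ s_k u` for a `B`-central element `c = ∑ t_k ⊗ s_k`. -/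
def actHom (c : Tens B (Module.End Aᵐᵒᵖ M) (Module.End Aᵐᵒᵖ M))
    (hc : ∀ b : B, (b • (1 : Module.End Aᵐᵒᵖ M)) • c = op (b • (1 : Module.End Aᵐᵒᵖ M)) • c) :
    BimodHom A A (Comatrix A B M) (Comatrix A B M) :=
  let r : Comatrix A B M →+ Comatrix A B M := Tens.lift
    (AddMonoidHom.mk' (fun f => AddMonoidHom.mk' (fun u => act f u c) (act_add_right c f))
      (fun f f' => AddMonoidHom.ext fun u => act_add_left c f f' u))
    -- Being balanced over `B` amounts to centrality: `f b` multiplies `c` by `b` on the left, `b u`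
    -- on the right.
    (fun f b u => by
      change act (RightDual.comp f (b • (1 : Module.End Aᵐᵒᵖ M))) u c =
        act f ((b • (1 : Module.End Aᵐᵒᵖ M)) u) c
      rw [act_comp, act_apply, hc])
  { toFun := r
    map_add' := r.map_add
    map_smul' := fun a z => by
      induction z using Tens.induction_on with
      | zero => simp
      | tmul f u => exact act_smul_left c a f u
      | add x y hx hy => rw [smul_add, map_add, hx, hy, map_add, smul_add]
    map_op_smul' := fun a z => by
      change r _ = op a • r _
      induction z using Tens.induction_on with
      | zero => simp
      | tmul f u => exact act_op_smul_right c a f u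
      | add x y hx hy => rw [smul_add, map_add, hx, hy, map_add, smul_add] }

/-- The coring endomorphism `f ⊗ u ↦ ∑ f t_k ⊗ s_k u` for a cocycle `c = ∑ t_k ⊗ s_k`. -/
def ofCoeff (D : DualBasis A M) (c : Tens B (Module.End Aᵐᵒᵖ M) (Module.End Aᵐᵒᵖ M))
    (hc : ∀ b : B, (b • (1 : Module.End Aᵐᵒᵖ M)) • c = op (b • (1 : Module.End Aᵐᵒᵖ M)) • c)
    (hmul : RingExtension.mulHom B _ c = 1) (hcoc : RingExtension.IsCocycle c) :
    CoringEnd (comatrixCoring B D) where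
  toBimodHom := actHom c hc
  counit_comp z := by
    change comatrixCounit A B M _ = comatrixCounit A B M z
    induction z using Tens.induction_on with
    | zero => rw [BimodHom.map_zero]
    | tmul f u =>
      change comatrixCounit A B M (act f u c) = _
      rw [counit_act, hmul]
      rfl
    | add x y hx hy => rw [BimodHom.map_add, BimodHom.map_add, BimodHom.map_add, hx, hy]
  comul_comp z := by
    change comatrixComul D _ = Tens.map _ _ (comatrixComul D z)
    induction z using Tens.induction_on with
    | zero => simp only [BimodHom.map_zero, map_zero]
    | tmul f u =>
      change comatrixComul D (act f u c) = _
      -- The cocycle condition is read from right to left, reversing the argument for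
      -- `coeff_isCocycle`.
      rw [← tripleAct_unitRight, ← hcoc, tripleAct_mulRight, comatrixComul_tmul, map_sum]
      rfl
    | add x y hx hy => simp only [BimodHom.map_add, map_add, hx, hy]

theorem coeff_eq (D : DualBasis A M) {g : CoringEnd (comatrixCoring B D)}
    {c : Tens B (Module.End Aᵐᵒᵖ M) (Module.End Aᵐᵒᵖ M)}
    (h : ∀ f u, g (Tens.tmul B f u) = act f u c) : coeff D g.toBimodHom = c :=
  eq_of_act_eq D fun f u => (act_coeff D _ f u).trans (h f u)

theorem CoringEnd.ext_coeff (D : DualBasis A M) {g h : CoringEnd (comatrixCoring B D)}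
    (e : coeff D g.toBimodHom = coeff D h.toBimodHom) : g = h := by
  have h1 : g.toBimodHom.toLinearMap.toAddMonoidHom = h.toBimodHom.toLinearMap.toAddMonoidHom :=
    Tens.addHom_ext fun f u =>
      (act_coeff D g.toBimodHom f u).symm.trans ((congrArg _ e).trans (act_coeff D _ f u))
  exact CoringEnd.ext fun z => DFunLike.congr_fun h1 z

/-! ### The sub-bimodule `Hom_𝒞(M, M_g)` -/

/-- Both sides of the colinearity equation have the form `∑ e_i ⊗ act (e_i^*) u z`: the induced
coaction at `t u` with `z = c t`, and `t` applied to the coaction at `u` with `z = t ⊗ 1` by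
centrality of the canonical element. -/
theorem mem_homInduced (D : DualBasis A M) (g : CoringEnd (comatrixCoring B D))
    (t : Module.End Aᵐᵒᵖ M) :
    t ∈ homInduced D g ↔ op t • coeff D g.toBimodHom = Tens.tmul B t 1 := by
  have h1 : ∀ u, ((canonicalComodule B D).induced g).coact (t u) =
      ∑ i, Tens.tmul A (D.e i) (act (D.eStar i) u (op t • coeff D g.toBimodHom)) := fun u => by
    simp only [← act_apply, act_coeff]
    change RightComodule.mapRight M g ((canonicalComodule B D).coact (t u)) = _
    rw [canonicalComodule_coact, map_sum]
    rfl
  have h2 : ∀ u, Tens.map t LinearMap.id ((canonicalComodule B D).coact u) =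
      ∑ i, Tens.tmul A (D.e i) (act (D.eStar i) u (Tens.tmul B t 1)) := fun u => by
    have h := congrArg (Tens.map (LinearMap.id : M →ₗ[Aᵐᵒᵖ] M) (Tens.tmulRight (T := B) u))
      (D.sum_comm t)
    rw [map_sum, map_sum] at h
    rw [canonicalComodule_coact, map_sum]
    exact h
  -- Contracting the first factor with `f` recovers `act f u z`, so these sums determine `z`.
  have h3 : ∀ (f : RightDual A M) (u : M)
      (z : Tens B (Module.End Aᵐᵒᵖ M) (Module.End Aᵐᵒᵖ M)),
      Tens.lid A _ (Tens.map (show M →ₗ[Aᵐᵒᵖ] A from f) LinearMap.id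
        (∑ i, Tens.tmul A (D.e i) (act (D.eStar i) u z))) = act f u z := fun f u z => by
    let l : RightDual A M →+ Comatrix A B M :=
      AddMonoidHom.mk' (fun f => act f u z) (fun f f' => act_add_left z f f' u)
    have h := congrArg l (D.sum_smul_eStar f)
    rw [map_sum] at h
    rw [map_sum, map_sum]
    exact (Finset.sum_congr rfl fun i _ => (act_smul_left z _ _ u).symm).trans h
  change (∀ u, _ = _) ↔ _
  simp only [h1, h2]
  exact ⟨fun h => eq_of_act_eq D fun f u => by rw [← h3, h, h3], fun h u => by rw [h]⟩

/-- For `s` colinear to `M_h` and `t` colinear to `M_g`, first `h` lets `s` out of the coaction at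
`s t u`; then `g`, which commutes with `s ⊗ 𝒞`, lets `t` out. Hence the reversed order. -/
theorem homInduced_mul_le (D : DualBasis A M) (g h : CoringEnd (comatrixCoring B D))
    {x : Module.End Aᵐᵒᵖ M} (hx : x ∈ homInduced D h * homInduced D g) :
    x ∈ homInduced D (g * h) := by
  refine SubBimodule.mul_induction hx (fun s hs t ht => ?_) (fun _ _ => add_mem)
  intro u
  have hst : ∀ z : Tens A M (Comatrix A B M),
      RightComodule.mapRight M g (Tens.map s LinearMap.id z) =
        Tens.map s LinearMap.id (RightComodule.mapRight M g z) := fun z => by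
    induction z using Tens.induction_on with
    | zero => simp
    | tmul m c => rfl
    | add x y hx hy => simp only [map_add, hx, hy]
  have hgh : ∀ z : Tens A M (Comatrix A B M), RightComodule.mapRight M (g * h) z =
      RightComodule.mapRight M g (RightComodule.mapRight M h z) := fun z => by
    induction z using Tens.induction_on with
    | zero => simp
    | tmul m c => rfl
    | add x y hx hy => simp only [map_add, hx, hy]
  change RightComodule.mapRight M (g * h) ((canonicalComodule B D).coact (s (t u))) = _
  have h1 : RightComodule.mapRight M h ((canonicalComodule B D).coact (s (t u))) = _ := hs (t u)
  have h2 : RightComodule.mapRight M g ((canonicalComodule B D).coact (t u)) = _ := ht u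
  rw [hgh, h1, hst, h2, map_comp_id]

end

/-! ### Faithfully flat bimodules -/

section

universe u v w

variable {A : Type w} {B : Type u} {M : Type v} [Ring A] [Ring B] [AddCommGroup M] [Module B M]

/-- Faithful flatness is tested on modules in `Type (max u v)`, but the quotients of `S` and `S ⊗_B
S` live in `Type v`; `ULift` bridges the gap. -/
theorem IsFaithfullyFlat.map_injective (h : IsFaithfullyFlat B M) {N N' : Type v}
    [AddCommGroup N] [Module Bᵐᵒᵖ N] [AddCommGroup N'] [Module Bᵐᵒᵖ N'] (f : N →ₗ[Bᵐᵒᵖ] N')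
    (hf : Function.Injective f) :
    Function.Injective (Tens.map f (LinearMap.id : M →ₗ[B] M)) := by
  let e : ULift.{u} N ≃ₗ[Bᵐᵒᵖ] N := ULift.moduleEquiv
  let e' : ULift.{u} N' ≃ₗ[Bᵐᵒᵖ] N' := ULift.moduleEquiv
  have h1 := h.1 _ _ ((e'.symm.toLinearMap.comp f).comp e.toLinearMap)
    ((e'.symm.injective.comp hf).comp e.injective)
  have h2 : Function.Injective (Tens.map e.symm.toLinearMap (LinearMap.id : M →ₗ[B] M)) :=
    Function.LeftInverse.injective (g := Tens.map e.toLinearMap LinearMap.id) fun z => by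
      rw [Tens.map_map, LinearEquiv.comp_symm]
      exact Tens.map_id_id z
  have h3 : ∀ z : Tens B N M, Tens.map ((e'.symm.toLinearMap.comp f).comp e.toLinearMap)
      LinearMap.id (Tens.map e.symm.toLinearMap LinearMap.id z) =
      Tens.map e'.symm.toLinearMap LinearMap.id (Tens.map f LinearMap.id z) := fun z => by
    rw [Tens.map_map, Tens.map_map]
    rfl
  intro z w hzw
  apply h2
  apply h1
  rw [h3, h3, hzw]

theorem IsFaithfullyFlat.subsingleton (h : IsFaithfullyFlat B M) {N : Type v}
    [AddCommGroup N] [Module Bᵐᵒᵖ N] (hN : ∀ (n : N) (m : M), Tens.tmul B n m = 0) :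
    Subsingleton N := by
  let e : ULift.{u} N ≃ₗ[Bᵐᵒᵖ] N := ULift.moduleEquiv
  have h0 : ∀ z : Tens B (ULift.{u} N) M, z = 0 := fun z => by
    induction z using Tens.induction_on with
    | zero => rfl
    | tmul x m =>
      have h1 := congrArg (Tens.map e.symm.toLinearMap (LinearMap.id : M →ₗ[B] M)) (hN (e x) m)
      rw [map_zero] at h1
      exact h1
    | add x y hx hy => rw [hx, hy, add_zero]
  have := h.2 (ULift.{u} N) ⟨fun z w => (h0 z).trans (h0 w).symm⟩
  exact e.symm.toEquiv.subsingleton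

variable [Module Aᵐᵒᵖ M] [SMulCommClass B Aᵐᵒᵖ M]

/-- If `_B M` is flat, then so is `_B S`, a direct summand of a power of `_B M`. -/
theorem IsFaithfullyFlat.map_end_injective (h : IsFaithfullyFlat B M) (D : DualBasis A M)
    {N N' : Type v} [AddCommGroup N] [Module Bᵐᵒᵖ N] [AddCommGroup N'] [Module Bᵐᵒᵖ N']
    (f : N →ₗ[Bᵐᵒᵖ] N') (hf : Function.Injective f) : Function.Injective
      (Tens.map f (LinearMap.id : Module.End Aᵐᵒᵖ M →ₗ[B] Module.End Aᵐᵒᵖ M)) := by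
  -- From `s = ∑ s(e_i) e_i^*`, an element of `N ⊗_B S` is recovered from its evaluations in `N ⊗_B
  -- M`.
  have h1 : ∀ z : Tens B N (Module.End Aᵐᵒᵖ M),
      ∑ i, Tens.map LinearMap.id (rankOneRight B (D.eStar i))
        (Tens.map LinearMap.id (evalAt B (D.e i)) z) = z := fun z => by
    induction z using Tens.induction_on with
    | zero => simp
    | tmul n s =>
      conv_rhs => rw [← D.sum_rankOne s, Tens.tmul_sum]
      rfl
    | add x y hx hy =>
      conv_rhs => rw [← hx, ← hy]
      simp only [map_add, Finset.sum_add_distrib]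
  have h2 : ∀ (z : Tens B N (Module.End Aᵐᵒᵖ M)) (u : M),
      Tens.map f LinearMap.id (Tens.map LinearMap.id (evalAt B u) z) =
        Tens.map LinearMap.id (evalAt B u) (Tens.map f LinearMap.id z) := fun z u => by
    rw [Tens.map_map, Tens.map_map]
    rfl
  intro z w hzw
  rw [← h1 z, ← h1 w]
  refine Finset.sum_congr rfl fun i _ => congrArg _ (h.map_injective f hf ?_)
  rw [h2, h2, hzw]

theorem IsFaithfullyFlat.eq_zero_of_tmul_one (h : IsFaithfullyFlat B M) {N : Type v}
    [AddCommGroup N] [Module Bᵐᵒᵖ N] (n : N)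
    (hn : Tens.tmul B n (1 : Module.End Aᵐᵒᵖ M) = 0) : n = 0 := by
  have h1 : ∀ m : M, Tens.tmul B n m = 0 := fun m => by
    have := congrArg (Tens.map LinearMap.id (evalAt B m)) hn
    rwa [map_zero] at this
  -- Evaluating at `m` turned `n ⊗ 1 = 0` into `n ⊗ m = 0`. By flatness `n B ⊗_B M` embeds in `N ⊗_B
  -- M`, where its image is zero, so faithfulness gives `n B = 0`.
  let p : Submodule Bᵐᵒᵖ N := Submodule.span Bᵐᵒᵖ {n}
  have h2 : Subsingleton p := h.subsingleton fun x m => by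
    apply h.map_injective p.subtype p.subtype_injective
    obtain ⟨b, hb⟩ := Submodule.mem_span_singleton.1 x.2
    rw [Tens.map_tmul, map_zero, Submodule.subtype_apply, ← hb, ← op_unop b, Tens.smul_tmul, h1]
  exact congrArg Subtype.val
    (Subsingleton.elim (⟨n, Submodule.mem_span_singleton_self n⟩ : p) 0)

end

/-! ### Separable bimodules -/

section

variable {A B M : Type*} [Ring A] [Ring B] [AddCommGroup M] [Module B M] [Module Aᵐᵒᵖ M]
  [SMulCommClass B Aᵐᵒᵖ M]

/-- If `_B M_A` is separable, then `B → End(M_A)` is a split ring extension. -/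
theorem IsSeparableBimodule.exists_split (h : IsSeparableBimodule A B M) :
    ∃ E : BimodHom B B (Module.End Aᵐᵒᵖ M) B, E 1 = 1 := by
  obtain ⟨σ, hσ⟩ := h
  have hadd : ∀ (s t : Module.End Aᵐᵒᵖ M) (z : Tens A M (LeftDual B M)),
      Tens.map (s + t) LinearMap.id z = Tens.map s LinearMap.id z + Tens.map t LinearMap.id z := by
    intro s t z
    induction z using Tens.induction_on with
    | zero => simp
    | tmul m f => exact Tens.add_tmul _ _ _
    | add x y hx hy => rw [map_add, map_add, map_add, hx, hy]; abel
  have hsmul : ∀ (b : B) (s : Module.End Aᵐᵒᵖ M) (z : Tens A M (LeftDual B M)),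
      Tens.map (b • s) LinearMap.id z = b • Tens.map s LinearMap.id z := by
    intro b s z
    induction z using Tens.induction_on with
    | zero => simp
    | tmul m f => rfl
    | add x y hx hy => rw [map_add, map_add, smul_add, hx, hy]
  have hcentral : ∀ b : B, b • σ 1 = op b • σ 1 := fun b => by
    have h1 : σ (b • (1 : B)) = b • σ 1 := σ.toLeft.map_smul b 1
    have h2 : σ (op b • (1 : B)) = op b • σ 1 := σ.map_op_smul' b 1
    rw [← h1, ← h2, smul_eq_mul, mul_one, op_smul_eq_mul, one_mul]
  -- If `σ(1) = ∑ m_k ⊗ φ_k`, the retraction is `E(s) = ∑ φ_k(s m_k)`. Centrality of `σ(1)` gives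
  -- right `B`-linearity, and `E(1)` is the evaluation of `σ(1)`, namely `1`.
  refine ⟨{ toFun := fun s => leftEval A B M (Tens.map s LinearMap.id (σ 1))
            map_add' := fun s t => by rw [hadd, BimodHom.map_add]
            map_smul' := fun b s => by
              rw [hsmul]
              exact (leftEval A B M).toLeft.map_smul b _
            map_op_smul' := fun b s => ?_ }, ?_⟩
  · change leftEval A B M (Tens.map (s * Module.toModuleEnd Aᵐᵒᵖ M b) LinearMap.id (σ 1)) = _
    rw [map_comp_id]
    change leftEval A B M (Tens.map s LinearMap.id (b • σ 1)) = _
    rw [hcentral, Tens.map_right_smul]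
    exact (leftEval A B M).map_op_smul' b _
  · change leftEval A B M (Tens.map LinearMap.id LinearMap.id (σ 1)) = 1
    rw [Tens.map_id_id, hσ]

end

/-! ### The anti-isomorphism -/

section

universe v

variable {A B : Type*} {M : Type v} [Ring A] [Ring B] [AddCommGroup M] [Module B M]
  [Module Aᵐᵒᵖ M] [SMulCommClass B Aᵐᵒᵖ M]

/-- The coring endomorphism given by a right invertible sub-bimodule. -/
noncomputable def ofRightInvertible (D : DualBasis A M)
    (I : SubBimodule.rightInvertible B (Module.End Aᵐᵒᵖ M)) : CoringEnd (comatrixCoring B D) :=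
  ofCoeff D (RingExtension.unitCoeff I) (RingExtension.unitCoeff_central I)
    (RingExtension.mulHom_unitCoeff I) (RingExtension.unitCoeff_isCocycle I)

theorem coeff_ofRightInvertible (D : DualBasis A M)
    (I : SubBimodule.rightInvertible B (Module.End Aᵐᵒᵖ M)) :
    coeff D (ofRightInvertible D I).toBimodHom = RingExtension.unitCoeff I :=
  coeff_eq D fun _ _ => rfl

/-- A right invertible sub-bimodule contained in `Hom_𝒞(M, M_g)` is equal to it. -/
theorem eq_homInduced_of_le
    (hS : ∀ (N : Type v) [AddCommGroup N] [Module Bᵐᵒᵖ N] (n : N),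
      Tens.tmul B n (1 : Module.End Aᵐᵒᵖ M) = 0 → n = 0)
    (D : DualBasis A M) (I : SubBimodule.rightInvertible B (Module.End Aᵐᵒᵖ M))
    (g : CoringEnd (comatrixCoring B D)) (h : ∀ t ∈ I.1, t ∈ homInduced D g) :
    I.1 = homInduced D g := by
  -- The inclusion alone forces the element of `I` to coincide with that of `g`; both sub-bimodules
  -- are then cut out by the same equation.
  have h1 := RingExtension.eq_unitCoeff I fun t ht => (mem_homInduced D g t).1 (h t ht)
  refine SetLike.ext fun t => ⟨h t, fun ht => RingExtension.mem_of_op_smul_unitCoeff hS I ?_⟩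
  rw [h1]
  exact (mem_homInduced D g t).1 ht

theorem ofRightInvertible_eq (D : DualBasis A M)
    (I : SubBimodule.rightInvertible B (Module.End Aᵐᵒᵖ M))
    (g : CoringEnd (comatrixCoring B D)) (h : I.1 = homInduced D g) :
    ofRightInvertible D I = g := by
  apply CoringEnd.ext_coeff
  rw [coeff_ofRightInvertible]
  exact RingExtension.eq_unitCoeff I fun t ht => (mem_homInduced D g t).1 (h ▸ ht)

theorem homInduced_ofRightInvertible
    (hS : ∀ (N : Type v) [AddCommGroup N] [Module Bᵐᵒᵖ N] (n : N),
      Tens.tmul B n (1 : Module.End Aᵐᵒᵖ M) = 0 → n = 0)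
    (D : DualBasis A M) (I : SubBimodule.rightInvertible B (Module.End Aᵐᵒᵖ M)) :
    homInduced D (ofRightInvertible D I) = I.1 :=
  (eq_homInduced_of_le hS D I _ fun t ht => (mem_homInduced D _ t).2 <| by
    rw [coeff_ofRightInvertible]
    exact RingExtension.op_smul_unitCoeff I t ht).symm

/-- Right invertible sub-bimodules are closed under products, so the easy inclusion
`homInduced_mul_le` upgrades to equality. -/
theorem homInduced_mul
    (hS : ∀ (N : Type v) [AddCommGroup N] [Module Bᵐᵒᵖ N] (n : N),
      Tens.tmul B n (1 : Module.End Aᵐᵒᵖ M) = 0 → n = 0)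
    (D : DualBasis A M)
    (hbij : ∀ g : CoringEnd (comatrixCoring B D),
      homInduced D g ∈ SubBimodule.rightInvertible B (Module.End Aᵐᵒᵖ M))
    (g h : CoringEnd (comatrixCoring B D)) :
    homInduced D (g * h) = homInduced D h * homInduced D g :=
  (eq_homInduced_of_le hS D ⟨_, mul_mem (hbij h) (hbij g)⟩ (g * h)
    fun _ => homInduced_mul_le D g h).symm

/-- The anti-isomorphism `g ↦ Hom_𝒞(M, M_g)`. -/
noncomputable def homInducedEquiv
    (hS : ∀ (N : Type v) [AddCommGroup N] [Module Bᵐᵒᵖ N] (n : N),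
      Tens.tmul B n (1 : Module.End Aᵐᵒᵖ M) = 0 → n = 0)
    (D : DualBasis A M)
    (hbij : ∀ g : CoringEnd (comatrixCoring B D),
      homInduced D g ∈ SubBimodule.rightInvertible B (Module.End Aᵐᵒᵖ M)) :
    CoringEnd (comatrixCoring B D) ≃* (SubBimodule.rightInvertible B (Module.End Aᵐᵒᵖ M))ᵐᵒᵖ where
  toFun g := op ⟨homInduced D g, hbij g⟩
  invFun I := ofRightInvertible D I.unop
  left_inv g := ofRightInvertible_eq D ⟨homInduced D g, hbij g⟩ g rfl
  right_inv I := unop_injective (Subtype.ext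
    (homInduced_ofRightInvertible hS D I.unop))
  map_mul' g h := unop_injective (Subtype.ext (homInduced_mul hS D hbij g h))

end

end ComatrixCoring

open ComatrixCoring MulOpposite in
theorem mainTheorem3 {A B M : Type*} [Ring A] [Ring B] [AddCommGroup M] [Module B M]
    [Module Aᵐᵒᵖ M] [SMulCommClass B Aᵐᵒᵖ M] [FaithfulSMul B M]
    [Module.Finite Aᵐᵒᵖ M] [Module.Projective Aᵐᵒᵖ M] (D : DualBasis A M)
    (h : IsFaithfullyFlat B M ∨ IsSeparableBimodule A B M) :
    ∃ F : CoringEnd (comatrixCoring B D) ≃*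
        (SubBimodule.rightInvertible B (Module.End Aᵐᵒᵖ M))ᵐᵒᵖ,
      (∀ g, ((F g).unop : SubBimodule B (Module.End Aᵐᵒᵖ M)) = homInduced D g) ∧
      ∀ (I : SubBimodule.rightInvertible B (Module.End Aᵐᵒᵖ M)) (n : ℕ)
        (t : Fin n → (I : SubBimodule B (Module.End Aᵐᵒᵖ M)))
        (s : Fin n → Module.End Aᵐᵒᵖ M),
        ∑ k, Tens.tmul B (t k) (s k) = (SubBimodule.mulEquiv I).symm 1 →
        ∀ (f : RightDual A M) (u : M),
          F.symm (op I) (Tens.tmul B f u) =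
            ∑ k, Tens.tmul B (RightDual.comp f (t k)) (s k u) := by
  have hbij : ∀ g : CoringEnd (comatrixCoring B D),
      homInduced D g ∈ SubBimodule.rightInvertible B (Module.End Aᵐᵒᵖ M) := fun g => by
    rcases h with h | h
    · exact RingExtension.mulMap_bijective_of_flat (fun _ _ _ _ _ _ => h.map_end_injective D)
        (mulHom_coeff D g) (coeff_isCocycle D g) (mem_homInduced D g)
    · obtain ⟨E, hE⟩ := h.exists_split
      exact RingExtension.mulMap_bijective_of_split hE
        (mulHom_coeff D g) (coeff_isCocycle D g) (mem_homInduced D g)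
  -- It remains to see that `n ⊗ 1 = 0` in `N ⊗_B S` forces `n = 0`: by faithful flatness, or by
  -- applying the retraction `E`.
  refine ⟨homInducedEquiv (fun N _ _ n hn => ?_) D hbij, fun g => rfl, ?_⟩
  · rcases h with h | h
    · exact h.eq_zero_of_tmul_one n hn
    · obtain ⟨E, hE⟩ := h.exists_split
      rw [← RingExtension.retract_tmul_one hE n, hn, map_zero]
  · intro I n t s hts f u
    -- The inverse is by construction the action of the image of `m⁻¹(1)`, so any expression of
    -- `m⁻¹(1)` as a sum of tensors yields the formula.
    change act f u (RingExtension.unitCoeff I) = _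
    rw [RingExtension.unitCoeff, ← hts, map_sum, map_sum]
    rfl
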